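/- Let $q\in\mathbb C$, $q\neq 0,1$, and fix $\ln q$ by $0\le\arg q<2\pi$, so that $q^{w}=e^{w\ln q}$ for $w\in\mathbb C$. Let $F(z,y_0,\dots,y_n)$ be a polynomial with complex coefficients. A *generalized formal power series* is a series $\varphi=\sum_{j\ge0}c_jz^{\lambda_j}$ with $c_j\in\mathbb C$ and distinct $\lambda_j\in\mathbb C$ such that $\operatorname{Re}\lambda_j\le\operatorname{Re}\lambda_{j+1}$ for all $j$ and $\operatorname{Re}\lambda_j\to+\infty$; these series form an algebra, on which $\sigma\bigl(\sum c_jz^{\lambda_j}\bigr)=\sum c_jq^{\lambda_j}z^{\lambda_j}$. Let $\varphi$ be such a series that formally solves $F(z,\varphi,\sigma\varphi,\dots,\sigma^n\varphi)=0$. Assume that there are $\alpha\in\mathbb C$ and $A_0,\dots,A_n\in\mathbb C$, not all zero, such that for every $k=0,\dots,n$ $$\frac{\partial F}{\partial y_k}(z,\varphi,\sigma\varphi,\dots,\sigma^n\varphi)=A_kz^{\alpha}+(\text{terms whose exponents have real part}>\operatorname{Re}\alpha),$$ and put $L(\xi)=A_n\xi^n+\dots+A_1\xi+A_0$. Let $j_0\ge0$,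 $\lambda=\lambda_{j_0}$, $\varphi_0=\sum_{j\le j_0}c_jz^{\lambda_j}$. Let $\alpha_1,\dots,\alpha_s\in\mathbb C$ with $\operatorname{Re}\alpha_i>0$ generate the additive semigroup $\Gamma=\{m_1\alpha_1+\dots+m_s\alpha_s:\ m_i\in\mathbb Z_{\ge0}\}$ (with zero), where the generators are chosen so that the exponents of the equation for $u$ obtained by the change of variable $y=\varphi_0+z^{\lambda}u$ lie in $\Gamma$; that is, every exponent of $z$ that occurs in $$z^{-\alpha-\lambda}F\bigl(z,\ \varphi_0+z^{\lambda}u_0,\ \sigma\varphi_0+q^{\lambda}z^{\lambda}u_1,\ \dots,\ \sigma^n\varphi_0+q^{n\lambda}z^{\lambda}u_n\bigr),$$ a polynomial in $u_0,\dots,u_n$, belongs to $\Gamma$. Suppose that $\varphi$ has the form $$\varphi=\sum_{j=0}^{j_0}c_jz^{\lambda_j}+\sum_{(m_1,\dots,m_s)\in\mathbb Z_{\ge0}^s\setminus\{0\}}c_{m_1,\dots,m_s}z^{\lambda+m_1\alpha_1+\dots+m_s\alpha_s},$$ that is, $\lambda_j-\lambda\in\Gamma$ for all $j>j_0$ with $c_j\ne0$.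 Theorem. If $\deg L=n$, $L(0)\neq0$, and for each root $a$ of the polynomial $(\xi-q^{\lambda})L(\xi)$ there are constants $c,\nu>0$ such that $$\bigl|(\lambda+m_1\alpha_1+\dots+m_s\alpha_s)\ln q-\ln a-2\pi m\mathrm i\bigr|>c\,(m_1+\dots+m_s)^{-\nu}$$ for all $(m_1,\dots,m_s)\in\mathbb Z_{\ge0}^s\setminus\{0\}$ and all $m\in\mathbb Z$, then $\varphi$ has a nonzero radius of convergence: for every sector with vertex at the origin and opening less than $2\pi$, and every branch of $\ln z$ on it, the series $\varphi$ converges uniformly (in any order of its terms) on the part $|z|<r$ of the sector for some $r>0$, and its sum is holomorphic there. -/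

import Mathlib

open Filter Topology

noncomputable section

namespace QDiff

/-- Complex exponents, ordered lexicographically (first by real part, then by imaginary part).
Hahn series over this ordered group form a ring that contains the generalized power series
(those with finitely many exponents in each half plane `Re ≤ R`) with their usual sum and
Cauchy product; the imaginary part only breaks ties. -/
abbrev Expo : Type := ℝ ×ₗ ℝ

/-- A complex number as an exponent. -/
def expo (w : ℂ) : Expo := toLex (w.re, w.im)

/-- An exponent as a complex number. -/
def Expo.val (e : Expo) : ℂ := ⟨(ofLex e).1, (ofLex e).2⟩

/-- The ring in which formal computations are made. -/
abbrev FormalRing : Type := HahnSeries Expo ℂ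

/-- The formal monomial `a z ^ w`. -/
def mono (w a : ℂ) : FormalRing := HahnSeries.single (expo w) a

/-- A generalized formal power series `∑ c_j z ^ {λ_j}`: distinct complex exponents whose real
parts are nondecreasing and tend to `+∞` (some `c_j` may vanish, so finite sums are included). -/
structure GenPowerSeries where
  /-- the coefficients `c_j` -/
  c : ℕ → ℂ
  /-- the exponents `λ_j` -/
  lam : ℕ → ℂ
  lam_injective : Function.Injective lam
  re_monotone : Monotone fun j => (lam j).re
  re_tendsto : Tendsto (fun j => (lam j).re) atTop atTop

lemma expo_injective : Function.Injective expo := by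
  intro a b h
  have h' := congrArg ofLex h
  simp only [expo, ofLex_toLex, Prod.mk.injEq] at h'
  exact Complex.ext h'.1 h'.2

lemma isPWO_range_expo (φ : GenPowerSeries) :
    (Set.range fun j => expo (φ.lam j)).IsPWO := by
  refine Set.partiallyWellOrderedOn_iff_exists_lt.mpr ?_
  intro f hf
  by_contra! hcon
  choose g hg using fun n => hf n
  have hre : ∀ n, (φ.lam (g n)).re ≤ (φ.lam (g 0)).re := by
    intro n
    rcases Nat.eq_zero_or_pos n with rfl | hn
    · exact le_rfl
    have h1 : f n < f 0 := hcon 0 n hn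
    rw [← hg n, ← hg 0] at h1
    have h2 := (Prod.Lex.le_iff.mp h1.le)
    simp only [expo, ofLex_toLex] at h2
    rcases h2 with h2 | h2
    · exact h2.le
    · exact h2.1.le
  obtain ⟨N, hN⟩ := (φ.re_tendsto.eventually_gt_atTop (φ.lam (g 0)).re).exists_forall_of_atTop
  have hlt : ∀ n, g n < N := by
    intro n
    by_contra! h
    exact absurd (hre n) (not_le.mpr (hN _ h))
  have hfin : ¬ Function.Injective (fun n => (⟨g n, hlt n⟩ : Fin N)) := not_injective_infinite_finite _
  apply hfin
  intro a b hab
  have hgab : g a = g b := by simpa using hab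
  have hfab : f a = f b := by rw [← hg a, ← hg b, hgab]
  rcases lt_trichotomy a b with h | h | h
  · exact absurd hfab (hcon a b h).ne'
  · exact h
  · exact absurd hfab (hcon b a h).ne

/-- The element of the formal ring given by a generalized power series: its coefficient at `λ_j`
is `c_j`, and all the other coefficients vanish. -/
def GenPowerSeries.toFormal (φ : GenPowerSeries) : FormalRing where
  coeff := Function.extend (fun j => expo (φ.lam j)) φ.c 0
  isPWO_support' := by
    refine (isPWO_range_expo φ).mono ?_
    intro e he
    by_contra hne
    exact he (Function.extend_apply' _ _ _ hne)

/-- The partial sum `∑_{j ≤ J} c_j z ^ {λ_j}`. -/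
def GenPowerSeries.initial (φ : GenPowerSeries) (J : ℕ) : FormalRing :=
  ∑ j ∈ Finset.range (J + 1), mono (φ.lam j) (φ.c j)

/-- The value of `ln q` with `0 ≤ arg q < 2π`. -/
def lnq (q : ℂ) : ℂ :=
  if 0 ≤ Complex.arg q then Complex.log q else Complex.log q + 2 * Real.pi * Complex.I

/-- `q ^ w` for the fixed value of `ln q`. -/
def qpow (q w : ℂ) : ℂ := Complex.exp (w * lnq q)

/-- The dilatation operator: `∑ c_e z ^ e ↦ ∑ c_e q ^ e z ^ e`. -/
def sigma (q : ℂ) (f : FormalRing) : FormalRing where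
  coeff e := qpow q e.val * f.coeff e
  isPWO_support' := f.isPWO_support.mono fun e he h => he (by simp [h])

/-- Polynomials `F(z, y_0, …, y_n)`, as polynomials in the `y_k` over `ℂ[z]`. -/
abbrev QPoly (n : ℕ) : Type := MvPolynomial (Fin (n + 1)) (Polynomial ℂ)

/-- The substitution of the formal monomial `z` in a polynomial in `z`. -/
def zHom : Polynomial ℂ →+* FormalRing := (Polynomial.aeval (mono 1 1)).toRingHom

/-- `F(z, f, σ f, …, σ^n f)`. -/
def substSeries {n : ℕ} (q : ℂ) (F : QPoly n) (f : FormalRing) : FormalRing :=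
  MvPolynomial.eval₂ zHom (fun k : Fin (n + 1) => (sigma q)^[k] f) F

/-- `L(ξ) = A_n ξ^n + … + A_0` is the polynomial associated with `F` and `f`, with exponent `a`:
it is nonzero, and each `∂F/∂y_k (z, f, σ f, …, σ^n f)` is `A_k z ^ a` plus terms whose exponents
have real parts bigger than `Re a`. -/
def IsAssociatedPoly {n : ℕ} (q : ℂ) (F : QPoly n) (f : FormalRing) (a : ℂ)
    (L : Polynomial ℂ) : Prop :=
  L ≠ 0 ∧ L.natDegree ≤ n ∧ ∀ k : Fin (n + 1), ∀ e : Expo,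
    (substSeries q (MvPolynomial.pderiv k F) f - mono a (L.coeff k)).coeff e ≠ 0 → a.re < e.val.re

/-- The polynomial `F(z, g + z^w u_0, σ g + q^w z^w u_1, …, σ^n g + q^{nw} z^w u_n)` in
`u_0, …, u_n`, that is, the result of the change of variable `y = g + z^w u` in `F`. -/
def shifted {n : ℕ} (q : ℂ) (F : QPoly n) (g : FormalRing) (w : ℂ) :
    MvPolynomial (Fin (n + 1)) FormalRing :=
  MvPolynomial.eval₂ (MvPolynomial.C.comp zHom)
    (fun k : Fin (n + 1) => MvPolynomial.C ((sigma q)^[k] g) +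
      MvPolynomial.C ((sigma q)^[k] (mono w 1)) * MvPolynomial.X k) F

/-- The additive semigroup with zero `{m_1 α_1 + … + m_s α_s : m_i ∈ ℤ_{≥ 0}}`. -/
def semigroup {s : ℕ} (α : Fin s → ℂ) : Set ℂ :=
  {w | ∃ m : Fin s → ℕ, w = ∑ i, (m i : ℂ) * α i}

/-- The value of the argument of `z` in `(θ, θ + 2π]`. -/
def argFrom (θ : ℝ) (z : ℂ) : ℝ := toIocMod Real.two_pi_pos θ (Complex.arg z)

/-- The open sector `{ρ e^{i t} : 0 < ρ < r, θ₁ < t < θ₂}` (for `θ₂ - θ₁ < 2π`). -/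
def sector (r θ₁ θ₂ : ℝ) : Set ℂ := {z | z ≠ 0 ∧ ‖z‖ < r ∧ argFrom θ₁ z < θ₂}

/-- `z ^ w` for the branch of the logarithm with argument in `(θ, θ + 2π]`. -/
def powFrom (θ : ℝ) (z w : ℂ) : ℂ :=
  Complex.exp (w * (Real.log ‖z‖ + argFrom θ z * Complex.I))

/-- Nonzero radius of convergence: in every sector with vertex `0`, opening less than `2π` and
sufficiently small radius, for every branch of the logarithm there, the series converges uniformly
(in any order of its terms), and its sum is holomorphic. -/
def GenPowerSeries.HasNonzeroRadius (φ : GenPowerSeries) : Prop :=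
  ∀ θ₁ θ₂ : ℝ, θ₁ < θ₂ → θ₂ - θ₁ < 2 * Real.pi → ∃ r : ℝ, 0 < r ∧ ∃ f : ℂ → ℂ,
    TendstoUniformlyOn
      (fun (J : Finset ℕ) z => ∑ j ∈ J, φ.c j * powFrom θ₁ z (φ.lam j))
      f atTop (sector r θ₁ θ₂) ∧
    DifferentiableOn ℂ f (sector r θ₁ θ₂)

end QDiff

end

/-!
Put `λ = λ_{j₀}`, `φ = φ₀ + z ^ λ ψ` and let `Γ` be the monoid of exponents, so that `ψ` has its
exponents in `Γ \ {0}`. Divided by `z ^ (a₀ + λ)`, the equation becomes a polynomial equation for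
`ψ, σ ψ, …, σ ^ n ψ` with finitely many exponents, all in `Γ`. By the chain rule its linear part has
the constant coefficients `q ^ (k λ) A_k`, hence (`exists_normal_form`) it reads
`L(q ^ λ σ) ψ = -Q(z, ψ, …, σ ^ n ψ)`, where the coefficients of degree at most one of `Q` have no
constant term. The coefficient of `ψ` at `γ` is therefore obtained from earlier ones through division
by `L(q ^ (λ + γ))`. Since `deg L = n` and `L(0) ≠ 0`, the factors `q ^ (k γ)` that come from `σ ^ k`
are harmless: only the proximity of `q ^ (λ + γ)` to a root of `L` causes a loss, and this loss is at
most a power of `Re γ`.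

The losses accumulate along the recursion, and a bound of each by itself would only give a
Gevrey estimate. The remedy is the counting argument of Siegel and Bruno: if `γ` and `γ + δ` both give
a small divisor for the same root, then `q ^ δ` is close to `1`, and the diophantine condition at the
root `q ^ λ` makes `Re δ` large. In place of a count on trees there is an explicit potential
(`exists_potential_of_separated`): for one threshold, a function `N` on `Γ` with
`N a + N b + 1 ≤ N (a + b)` whenever `a + b` has a small divisor, and without the `1` otherwise, that
still grows at most linearly, with a slope inversely proportional to the separation. Summed over dyadic
thresholds and over the roots it gives `P` with `P a + P b + T (a + b) ≤ P (a + b)` and `P = O(Re)`,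
where `exp (T γ)` is the size of the inverse divisor (`exists_potential_of_polynomial`).

In the norm `∑ |f_e| r ^ {Re e} exp (-P(e))` the small divisors are thus absorbed. If the norm is cut
off at `Re e ≤ R`, the equation bounds the norm of `ψ` up to `R + w₀` by that up to `R`, where `w₀ > 0`
is a lower bound for the real parts on `Γ \ {0}`, because every term of `Q` that contains `ψ` is a
product of at least two factors with exponents in `Γ \ {0}`; for small `r` a bound uniform in `R` follows by
induction (`exists_wnorm_lt_top`). As `P` is at most linear, `∑ |c_j| ρ ^ {Re (λ_j - λ)}` converges for some
`ρ > 0`, and as `Γ` lies in a proper cone around the positive axis, the Weierstrass test applies in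
sectors (`GenPowerSeries.hasNonzeroRadius_of_summable`).
-/

noncomputable section

open scoped ENNReal

namespace QDiff

/-! ### Potentials that absorb small divisors -/

/-- The potential for one threshold. If any two comparable exponents with a small divisor (the
bad ones) differ by at least `m` in real part, then `N` increases by one at each of them, and still
grows at most linearly. For `m ≤ Re g` the value of `N` is the infimum of `2 Re g / m - 1` and the
numbers `2 Re g' / m - 2`, where `g'` is bad and lies above `g`: the latter leave room for the increment
at `g'`, even if `g'` is close to `g`. -/
theorem exists_potential_of_separated (Γ : AddSubmonoid ℂ) (hpos : ∀ g ∈ Γ, g ≠ 0 → 0 < g.re)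
    (Bad : ℂ → Prop) (m : ℝ) (hm : 0 < m)
    (hbad : ∀ g ∈ Γ, g ≠ 0 → Bad g → m ≤ g.re)
    (hsep : ∀ g ∈ Γ, ∀ d ∈ Γ, d ≠ 0 → Bad g → Bad (g + d) → m ≤ d.re) :
    ∃ N : ℂ → ℝ, (∀ g ∈ Γ, 0 ≤ N g ∧ N g ≤ 2 * g.re / m) ∧
      (∀ g ∈ Γ, g ≠ 0 → Bad g → 1 ≤ N g) ∧
      (∀ a ∈ Γ, ∀ b ∈ Γ, a ≠ 0 → b ≠ 0 → N a + N b ≤ N (a + b)) ∧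
      (∀ a ∈ Γ, ∀ b ∈ Γ, a ≠ 0 → b ≠ 0 → Bad (a + b) → N a + N b + 1 ≤ N (a + b)) := by
  classical
  have hnn : ∀ g ∈ Γ, 0 ≤ g.re := fun g hg => by
    by_cases h : g = 0
    · simp [h]
    · exact (hpos g hg h).le
  let S : ℂ → Set ℝ := fun g => insert (2 * g.re / m - 1)
    {x | ∃ d ∈ Γ, d ≠ 0 ∧ Bad (g + d) ∧ x = 2 * (g + d).re / m - 2}
  let N : ℂ → ℝ := fun g => if g.re < m then 0 else sInf (S g)
  have hSne : ∀ g, (S g).Nonempty := fun g => ⟨_, Set.mem_insert _ _⟩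
  have hS0 : ∀ g ∈ Γ, m ≤ g.re → ∀ x ∈ S g, 0 ≤ x := by
    rintro g hg hgm x (rfl | ⟨d, hd, hd0, hb, rfl⟩)
    · rw [sub_nonneg, le_div_iff₀ hm]; linarith
    · rw [sub_nonneg, le_div_iff₀ hm, Complex.add_re]
      linarith [hbad (g + d) (add_mem hg hd) (fun h => by
        have := hpos d hd hd0
        have h' := congrArg Complex.re h
        simp at h'; linarith [hnn g hg]) hb, hpos d hd hd0]
  have hSb : ∀ g ∈ Γ, m ≤ g.re → BddBelow (S g) := fun g hg hgm => ⟨0, hS0 g hg hgm⟩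
  have hNbig : ∀ g, m ≤ g.re → N g = sInf (S g) := fun g hg => if_neg (not_lt.mpr hg)
  have hNsmall : ∀ g, g.re < m → N g = 0 := fun g hg => if_pos hg
  have hN0 : ∀ g ∈ Γ, 0 ≤ N g := by
    intro g hg
    rcases lt_or_ge g.re m with h | h
    · rw [hNsmall g h]
    · rw [hNbig g h]; exact le_csInf (hSne g) (hS0 g hg h)
  have hN1 : ∀ g ∈ Γ, m ≤ g.re → N g ≤ 2 * g.re / m - 1 := by
    intro g hg h
    rw [hNbig g h]; exact csInf_le (hSb g hg h) (Set.mem_insert _ _)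
  have hN2 : ∀ g ∈ Γ, m ≤ g.re → ∀ d ∈ Γ, d ≠ 0 → Bad (g + d) →
      N g ≤ 2 * (g + d).re / m - 2 := by
    intro g hg h d hd hd0 hb
    rw [hNbig g h]; exact csInf_le (hSb g hg h) (Set.mem_insert_of_mem _ ⟨d, hd, hd0, hb, rfl⟩)
  -- the infimum at a bad exponent is attained at its first term
  have hNbad : ∀ g ∈ Γ, g ≠ 0 → Bad g → N g = 2 * g.re / m - 1 := by
    intro g hg hg0 hb
    have h := hbad g hg hg0 hb
    refine le_antisymm (hN1 g hg h) ?_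
    rw [hNbig g h]
    refine le_csInf (hSne g) ?_
    rintro x (rfl | ⟨d, hd, hd0, hb', rfl⟩)
    · exact le_rfl
    · have := hsep g hg d hd hd0 hb hb'
      have h2 : (2 * (g + d).re) / m = 2 * g.re / m + 2 * (d.re / m) := by
        rw [Complex.add_re]; ring
      have h3 : 1 ≤ d.re / m := by rwa [le_div_iff₀ hm, one_mul]
      linarith
  have hne : ∀ a ∈ Γ, ∀ b ∈ Γ, b ≠ 0 → a + b ≠ 0 := fun a ha b hb hb0 h => by
    have h' := congrArg Complex.re h
    simp only [Complex.add_re, Complex.zero_re] at h'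
    linarith [hnn a ha, hpos b hb hb0]
  have hmono : ∀ a b : ℂ, 0 ≤ b.re → 2 * a.re / m ≤ 2 * (a + b).re / m := fun a b hb => by
    rw [Complex.add_re]; gcongr; linarith
  have hadd : ∀ a b : ℂ, 2 * (a + b).re / m = 2 * a.re / m + 2 * b.re / m := fun a b => by
    rw [Complex.add_re]; ring
  -- at most one of the summands is big
  have key1 : ∀ a ∈ Γ, ∀ b ∈ Γ, b ≠ 0 → b.re < m → N a ≤ N (a + b) := by
    intro a ha b hb hb0 hbm
    rcases lt_or_ge a.re m with h | h
    · rw [hNsmall a h]; exact hN0 _ (add_mem ha hb)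
    have hab : m ≤ (a + b).re := by rw [Complex.add_re]; linarith [hnn b hb]
    rw [hNbig _ hab]
    refine le_csInf (hSne _) ?_
    rintro x (rfl | ⟨d, hd, hd0, hb', rfl⟩)
    · linarith [hN1 a ha h, hmono a b (hnn b hb)]
    · rw [add_assoc] at hb' ⊢
      exact hN2 a ha h _ (add_mem hb hd) (hne b hb d hd hd0) hb'
  have key2 : ∀ a ∈ Γ, ∀ b ∈ Γ, b ≠ 0 → Bad (a + b) → N a + 1 ≤ N (a + b) := by
    intro a ha b hb hb0 hB
    have h0 := hne a ha b hb hb0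
    have hm' := hbad _ (add_mem ha hb) h0 hB
    rw [hNbad _ (add_mem ha hb) h0 hB]
    rcases lt_or_ge a.re m with h | h
    · rw [hNsmall a h]
      have : 2 ≤ 2 * (a + b).re / m := by rw [le_div_iff₀ hm]; linarith
      linarith
    · linarith [hN2 a ha h b hb hb0 hB]
  have key3 : ∀ a ∈ Γ, ∀ b ∈ Γ, b ≠ 0 → m ≤ a.re → m ≤ b.re → N a + N b ≤ N (a + b) := by
    intro a ha b hb hb0 h h'
    have hab : m ≤ (a + b).re := by rw [Complex.add_re]; linarith [hnn b hb]
    have h1 := hN1 a ha h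
    have h2 := hN1 b hb h'
    rw [hNbig _ hab]
    refine le_csInf (hSne _) ?_
    rintro x (rfl | ⟨d, hd, hd0, hb', rfl⟩)
    · linarith [hadd a b]
    · linarith [hadd a b, hmono (a + b) d (hnn d hd)]
  refine ⟨N, fun g hg => ⟨hN0 g hg, ?_⟩, ?_, ?_, ?_⟩
  · rcases lt_or_ge g.re m with h | h
    · rw [hNsmall g h]; have := hnn g hg; positivity
    · linarith [hN1 g hg h]
  · intro g hg hg0 hb
    rw [hNbad g hg hg0 hb]
    have : 2 ≤ 2 * g.re / m := by rw [le_div_iff₀ hm]; linarith [hbad g hg hg0 hb]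
    linarith
  · intro a ha b hb ha0 hb0
    rcases lt_or_ge b.re m with h | h
    · rw [hNsmall b h, add_zero]; exact key1 a ha b hb hb0 h
    rcases lt_or_ge a.re m with h' | h'
    · rw [hNsmall a h', zero_add, add_comm]; exact key1 b hb a ha ha0 h'
    · exact key3 a ha b hb hb0 h' h
  · intro a ha b hb ha0 hb0 hB
    rcases lt_or_ge b.re m with h | h
    · rw [hNsmall b h, add_zero]; exact key2 a ha b hb hb0 hB
    rcases lt_or_ge a.re m with h' | h'
    · rw [hNsmall a h', zero_add, add_comm a]; rw [add_comm] at hB; exact key2 b hb a ha ha0 hB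
    · rw [hNbad _ (add_mem ha hb) (hne a ha b hb hb0) hB]
      linarith [hN1 a ha h', hN1 b hb h, hadd a b]

/-- The potential for one root `a`: the sum of the potentials for the thresholds `|a| / 2 ^ (j + 1)`.
The separation for the threshold with index `j` is at least `κ θ ^ j` with `θ > 1`, so that the sum
converges. -/
theorem exists_potential_of_diophantine (Γ : AddSubmonoid ℂ)
    (hpos : ∀ g ∈ Γ, g ≠ 0 → 0 < g.re) (ξ : ℂ → ℂ) (μ : ℂ → ℂ)
    (hξ : ∀ g d, ξ (g + d) = ξ g * μ d) (a : ℂ) (ha : a ≠ 0) (c ν : ℝ) (hc : 0 < c) (hν : 0 < ν)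
    (hdio : ∀ g ∈ Γ, g ≠ 0 → c * g.re ^ (-ν) ≤ ‖ξ g - a‖)
    (hdio1 : ∀ g ∈ Γ, g ≠ 0 → c * g.re ^ (-ν) ≤ ‖μ g - 1‖) :
    ∃ (P : ℂ → ℝ) (K : ℝ), (∀ g ∈ Γ, 0 ≤ P g ∧ P g ≤ K * g.re) ∧
      (∀ g ∈ Γ, g ≠ 0 → Real.log (max 1 (‖a‖ / 2 / ‖ξ g - a‖)) ≤ P g) ∧
      (∀ b ∈ Γ, ∀ d ∈ Γ, b ≠ 0 → d ≠ 0 →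
        P b + P d + Real.log (max 1 (‖a‖ / 2 / ‖ξ (b + d) - a‖)) ≤ P (b + d)) := by
  classical
  set ρ := ‖a‖ / 2 with hρ
  have hρ0 : 0 < ρ := by positivity
  have hne : ∀ b ∈ Γ, ∀ d ∈ Γ, b ≠ 0 → d ≠ 0 → b + d ≠ 0 := fun b hb d hd hb0 hd0 h => by
    have h' := congrArg Complex.re h
    simp only [Complex.add_re, Complex.zero_re] at h'
    linarith [hpos b hb hb0, hpos d hd hd0]
  -- exponents whose divisors are below `ρ / 2 ^ j` are separated by at least `κ * θ ^ j`
  let κ : ℝ := min (c / ρ) (c / 2) ^ ν⁻¹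
  have hκb : 0 < min (c / ρ) (c / 2) := lt_min (by positivity) (by positivity)
  have hκ : 0 < κ := Real.rpow_pos_of_pos hκb _
  let θ : ℝ := (2 : ℝ) ^ ν⁻¹
  have hθ : 1 < θ := Real.one_lt_rpow (by norm_num) (by positivity)
  have hscale : ∀ (x : ℝ) (j : ℕ), 0 < x → min (c / ρ) (c / 2) * x ^ (-ν) ≤ (2 ^ j)⁻¹ →
      κ * θ ^ j ≤ x := by
    intro x j hx h
    have h1 : min (c / ρ) (c / 2) * 2 ^ j ≤ x ^ ν := by
      rw [Real.rpow_neg hx.le] at h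
      have hxν : 0 < x ^ ν := Real.rpow_pos_of_pos hx _
      field_simp at h
      linarith
    have h2 := Real.rpow_le_rpow (by positivity) h1 (inv_nonneg.mpr hν.le)
    rw [Real.rpow_rpow_inv hx.le hν.ne', Real.mul_rpow hκb.le (by positivity)] at h2
    calc κ * θ ^ j = κ * (2 ^ j : ℝ) ^ ν⁻¹ := by
          congr 1
          rw [← Real.rpow_natCast, ← Real.rpow_natCast, ← Real.rpow_mul (by norm_num),
            ← Real.rpow_mul (by norm_num), mul_comm]
      _ ≤ x := h2
  have hex : ∀ j : ℕ, _ := fun j => exists_potential_of_separated Γ hpos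
    (fun g => ‖ξ g - a‖ < ρ * (2 ^ j)⁻¹) (κ * θ ^ j) (by positivity)
    (by
      intro g hg hg0 hb
      refine hscale _ j (hpos g hg hg0) ?_
      have h1 := (hdio g hg hg0).trans hb.le
      have h2 : 0 < g.re ^ (-ν) := Real.rpow_pos_of_pos (hpos g hg hg0) _
      calc min (c / ρ) (c / 2) * g.re ^ (-ν) ≤ c / ρ * g.re ^ (-ν) := by gcongr; exact min_le_left _ _
        _ = (c * g.re ^ (-ν)) / ρ := by ring
        _ ≤ (ρ * (2 ^ j)⁻¹) / ρ := by gcongr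
        _ = _ := by field_simp)
    (by
      intro g hg d hd hd0 hb hb'
      refine hscale _ j (hpos d hd hd0) ?_
      have h2 : 0 < d.re ^ (-ν) := Real.rpow_pos_of_pos (hpos d hd hd0) _
      have h3 : (2 ^ j : ℝ)⁻¹ ≤ 1 := inv_le_one_of_one_le₀ (one_le_pow₀ (by norm_num))
      have hξg : ρ ≤ ‖ξ g‖ := by
        have h4 : ‖a‖ ≤ ‖ξ g‖ + ‖ξ g - a‖ := by
          have := norm_sub_le (ξ g) (ξ g - a); simpa using this
        have h5 : ρ * (2 ^ j : ℝ)⁻¹ ≤ ρ := mul_le_of_le_one_right hρ0.le h3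
        linarith
      have h6 : ‖ξ g‖ * ‖μ d - 1‖ ≤ 2 * (ρ * (2 ^ j : ℝ)⁻¹) := by
        rw [← norm_mul]
        have : ξ g * (μ d - 1) = (ξ (g + d) - a) - (ξ g - a) := by rw [hξ]; ring
        rw [this]
        refine (norm_sub_le _ _).trans ?_
        linarith
      have h7 : ρ * (c * d.re ^ (-ν)) ≤ 2 * (ρ * (2 ^ j : ℝ)⁻¹) :=
        (mul_le_mul hξg (hdio1 d hd hd0) (by positivity) (norm_nonneg _)).trans h6
      have h8 : c * d.re ^ (-ν) ≤ 2 * (2 ^ j : ℝ)⁻¹ := by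
        refine le_of_mul_le_mul_left ?_ hρ0
        linarith
      calc min (c / ρ) (c / 2) * d.re ^ (-ν) ≤ c / 2 * d.re ^ (-ν) := by gcongr; exact min_le_right _ _
        _ ≤ _ := by linarith)
  choose N hN01 hNbad hNadd hNaddbad using hex
  have hsumθ : Summable fun j : ℕ => (θ⁻¹) ^ j :=
    summable_geometric_of_lt_one (by positivity) (inv_lt_one_of_one_lt₀ hθ)
  have hbound : ∀ (g : ℂ) (j : ℕ), 2 * g.re / (κ * θ ^ j) = 2 * g.re / κ * (θ⁻¹) ^ j := fun g j => by
    rw [inv_pow]; field_simp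
  have hsum : ∀ g ∈ Γ, Summable fun j => N j g := fun g hg =>
    Summable.of_nonneg_of_le (fun j => (hN01 j g hg).1) (fun j => (hN01 j g hg).2)
      (by simp_rw [hbound]; exact hsumθ.mul_left _)
  -- the number of dyadic thresholds that a divisor is below
  have hcount : ∀ g ∈ Γ, g ≠ 0 → ∀ f : ℕ → ℝ, Summable f →
      (∀ j, 0 ≤ f j) → (∀ j, ‖ξ g - a‖ < ρ * (2 ^ j)⁻¹ → 1 ≤ f j) →
      Real.log (max 1 (ρ / ‖ξ g - a‖)) ≤ Real.log 2 * ∑' j, f j := by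
    intro g hg hg0 f hf hf0 hf1
    have hd : 0 < ‖ξ g - a‖ := lt_of_lt_of_le (mul_pos hc (Real.rpow_pos_of_pos (hpos g hg hg0) _))
      (hdio g hg hg0)
    have hl2 : 0 < Real.log 2 := Real.log_pos (by norm_num)
    rcases le_or_gt (ρ / ‖ξ g - a‖) 1 with h | h
    · rw [max_eq_left h, Real.log_one]
      exact mul_nonneg hl2.le (tsum_nonneg hf0)
    rw [max_eq_right h.le]
    set x := Real.log (ρ / ‖ξ g - a‖) / Real.log 2 with hx
    have h1 : ∀ j ∈ Finset.range ⌈x⌉₊, (1 : ℝ) ≤ f j := by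
      intro j hj
      refine hf1 j ?_
      have hj' : (j : ℝ) < x := Nat.lt_ceil.mp (Finset.mem_range.mp hj)
      rw [hx, lt_div_iff₀ hl2, ← Real.log_pow, Real.log_lt_log_iff (by positivity) (by positivity),
        lt_div_iff₀ hd] at hj'
      rw [← div_eq_mul_inv, lt_div_iff₀ (by positivity)]
      linarith
    have h2 : (⌈x⌉₊ : ℝ) ≤ ∑' j, f j := by
      have := Finset.sum_le_sum h1
      simp only [Finset.sum_const, Finset.card_range, nsmul_eq_mul, mul_one] at this
      exact this.trans (hf.sum_le_tsum _ fun j _ => hf0 j)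
    have h3 := (Nat.le_ceil x).trans h2
    rw [hx, div_le_iff₀ hl2] at h3
    linarith
  have hl2 : 0 < Real.log 2 := Real.log_pos (by norm_num)
  refine ⟨fun g => Real.log 2 * ∑' j, N j g,
    Real.log 2 * (2 / κ * ∑' j : ℕ, (θ⁻¹) ^ j), fun g hg => ⟨?_, ?_⟩, ?_, ?_⟩
  · exact mul_nonneg hl2.le (tsum_nonneg fun j => (hN01 j g hg).1)
  · rw [mul_assoc]
    refine mul_le_mul_of_nonneg_left ?_ hl2.le
    have h1 := (hsum g hg).tsum_le_tsum (g := fun j => 2 * g.re / κ * (θ⁻¹) ^ j)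
      (fun j => by rw [← hbound]; exact (hN01 j g hg).2) (hsumθ.mul_left _)
    rw [tsum_mul_left] at h1
    refine h1.trans (le_of_eq ?_)
    ring
  · intro g hg hg0
    exact hcount g hg hg0 _ (hsum g hg) (fun j => (hN01 j g hg).1) (fun j hj => hNbad j g hg hg0 hj)
  · intro b hb d hd hb0 hd0
    have hs := ((hsum _ (add_mem hb hd)).sub (hsum b hb)).sub (hsum d hd)
    have h := hcount (b + d) (add_mem hb hd) (hne b hb d hd hb0 hd0) _ hs
      (fun j => by linarith [hNadd j b hb d hd hb0 hd0])
      (fun j hj => by linarith [hNaddbad j b hb d hd hb0 hd0 hj])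
    rw [((hsum _ (add_mem hb hd)).sub (hsum b hb)).tsum_sub (hsum d hd),
      (hsum _ (add_mem hb hd)).tsum_sub (hsum b hb)] at h
    linarith

/-- Potentials add up over the roots of a polynomial. The factors
`max 1 (|a| / 2 / |ξ - a|)` are chosen such that their product with `|ξ - a|` also dominates
`max 1 |ξ|`. -/
theorem exists_potential_of_multiset (Γ : AddSubmonoid ℂ)
    (hpos : ∀ g ∈ Γ, g ≠ 0 → 0 < g.re) (ξ : ℂ → ℂ) (μ : ℂ → ℂ)
    (hξ : ∀ g d, ξ (g + d) = ξ g * μ d) (s : Multiset ℂ)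
    (hs : ∀ a ∈ s, a ≠ 0 ∧ ∃ c ν : ℝ, 0 < c ∧ 0 < ν ∧ ∀ g ∈ Γ, g ≠ 0 →
      c * g.re ^ (-ν) ≤ ‖ξ g - a‖ ∧ c * g.re ^ (-ν) ≤ ‖μ g - 1‖) :
    ∃ (P T : ℂ → ℝ) (K C : ℝ), 0 < C ∧ (∀ g ∈ Γ, 0 ≤ P g ∧ P g ≤ K * g.re) ∧
      (∀ g ∈ Γ, 0 ≤ T g) ∧ (∀ g ∈ Γ, g ≠ 0 → T g ≤ P g) ∧
      (∀ b ∈ Γ, ∀ d ∈ Γ, b ≠ 0 → d ≠ 0 → P b + P d + T (b + d) ≤ P (b + d)) ∧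
      ∀ g ∈ Γ, g ≠ 0 → max 1 ‖ξ g‖ ^ s.card ≤
        C * (‖(s.map fun a => ξ g - a).prod‖ * Real.exp (T g)) := by
  induction s using Multiset.induction_on with
  | empty => exact ⟨0, 0, 0, 1, one_pos, by simp⟩
  | cons a s ih =>
    obtain ⟨P, T, K, C, hC, hP, hT, hTP, hadd, hdiv⟩ := ih fun b hb => hs b (Multiset.mem_cons_of_mem hb)
    obtain ⟨ha, c, ν, hc, hν, hdio⟩ := hs a (Multiset.mem_cons_self a s)
    obtain ⟨P', K', hP', hTP', hadd'⟩ := exists_potential_of_diophantine Γ hpos ξ μ hξ a ha c ν hc hν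
      (fun g hg hg0 => (hdio g hg hg0).1) (fun g hg hg0 => (hdio g hg hg0).2)
    have ha' : 0 < ‖a‖ := norm_pos_iff.mpr ha
    refine ⟨P + P', fun g => T g + Real.log (max 1 (‖a‖ / 2 / ‖ξ g - a‖)), K + K',
      max 3 (2 / ‖a‖) * C, by positivity, ?_, ?_, ?_, ?_, ?_⟩
    · intro g hg
      have h1 := hP g hg
      have h2 := hP' g hg
      simp only [Pi.add_apply, add_mul]
      constructor <;> linarith
    · intro g hg
      exact add_nonneg (hT g hg) (Real.log_nonneg (le_max_left _ _))
    · intro g hg hg0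
      exact add_le_add (hTP g hg hg0) (hTP' g hg hg0)
    · intro b hb d hd hb0 hd0
      have h1 := hadd b hb d hd hb0 hd0
      have h2 := hadd' b hb d hd hb0 hd0
      simp only [Pi.add_apply]
      linarith
    · intro g hg hg0
      have h1 := hdiv g hg hg0
      have hd : 0 < ‖ξ g - a‖ := lt_of_lt_of_le
        (mul_pos hc (Real.rpow_pos_of_pos (hpos g hg hg0) _)) (hdio g hg hg0).1
      have h2 : ‖ξ g - a‖ * max 1 (‖a‖ / 2 / ‖ξ g - a‖) = max ‖ξ g - a‖ (‖a‖ / 2) := by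
        rw [mul_max_of_nonneg _ _ hd.le, mul_one, mul_div_cancel₀ _ hd.ne']
      have h3 : max 1 ‖ξ g‖ ≤ max 3 (2 / ‖a‖) * (‖ξ g - a‖ * max 1 (‖a‖ / 2 / ‖ξ g - a‖)) := by
        rw [h2]
        refine max_le ?_ ?_
        · calc (1 : ℝ) = 2 / ‖a‖ * (‖a‖ / 2) := by field_simp
            _ ≤ _ := by gcongr <;> exact le_max_right _ _
        · have h4 : ‖ξ g‖ ≤ ‖ξ g - a‖ + ‖a‖ := by
            simpa using norm_add_le (ξ g - a) a
          have h5 := le_max_left ‖ξ g - a‖ (‖a‖ / 2)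
          have h6 := le_max_right ‖ξ g - a‖ (‖a‖ / 2)
          calc ‖ξ g‖ ≤ 3 * max ‖ξ g - a‖ (‖a‖ / 2) := by linarith
            _ ≤ _ := by gcongr; exact le_max_left _ _
      rw [Multiset.card_cons, pow_succ', Multiset.map_cons, Multiset.prod_cons, norm_mul,
        Real.exp_add, Real.exp_log (lt_of_lt_of_le one_pos (le_max_left _ _))]
      calc _ ≤ _ := mul_le_mul h3 h1 (by positivity) (by positivity)
        _ = _ := by ring

theorem exists_potential_of_polynomial (Γ : AddSubmonoid ℂ)
    (hpos : ∀ g ∈ Γ, g ≠ 0 → 0 < g.re) (ξ : ℂ → ℂ) (μ : ℂ → ℂ)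
    (hξ : ∀ g d, ξ (g + d) = ξ g * μ d) (L : Polynomial ℂ) (hL : L ≠ 0)
    (hs : ∀ a, L.IsRoot a → a ≠ 0 ∧ ∃ c ν : ℝ, 0 < c ∧ 0 < ν ∧ ∀ g ∈ Γ, g ≠ 0 →
      c * g.re ^ (-ν) ≤ ‖ξ g - a‖ ∧ c * g.re ^ (-ν) ≤ ‖μ g - 1‖) :
    ∃ (P T : ℂ → ℝ) (K C : ℝ), 0 < C ∧ (∀ g ∈ Γ, 0 ≤ P g ∧ P g ≤ K * g.re) ∧
      (∀ g ∈ Γ, 0 ≤ T g) ∧ (∀ g ∈ Γ, g ≠ 0 → T g ≤ P g) ∧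
      (∀ b ∈ Γ, ∀ d ∈ Γ, b ≠ 0 → d ≠ 0 → P b + P d + T (b + d) ≤ P (b + d)) ∧
      ∀ g ∈ Γ, g ≠ 0 → ∀ k ≤ L.natDegree, ‖ξ g‖ ^ k ≤
        C * (‖L.eval (ξ g)‖ * Real.exp (T g)) := by
  obtain ⟨P, T, K, C, hC, hP, hT, hTP, hadd, hdiv⟩ := exists_potential_of_multiset Γ hpos ξ μ hξ
    L.roots (fun a ha => hs a (Polynomial.isRoot_of_mem_roots ha))
  have hsplit := IsAlgClosed.splits L
  have hlc : 0 < ‖L.leadingCoeff‖ := norm_pos_iff.mpr (Polynomial.leadingCoeff_ne_zero.mpr hL)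
  refine ⟨P, T, K, C / ‖L.leadingCoeff‖, by positivity, hP, hT, hTP, hadd, ?_⟩
  intro g hg hg0 k hk
  have h1 := hdiv g hg hg0
  rw [← hsplit.natDegree_eq_card_roots] at h1
  have h2 : L.eval (ξ g) = L.leadingCoeff * (L.roots.map fun a => ξ g - a).prod :=
    hsplit.eval_eq_prod_roots _
  rw [h2, norm_mul]
  calc ‖ξ g‖ ^ k ≤ max 1 ‖ξ g‖ ^ k := by gcongr; exact le_max_right _ _
    _ ≤ max 1 ‖ξ g‖ ^ L.natDegree := pow_le_pow_right₀ (le_max_left _ _) hk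
    _ ≤ _ := h1
    _ = _ := by field_simp

/-! ### Exponents and supports -/

lemma Expo.val_zero : (0 : Expo).val = 0 := rfl
lemma Expo.val_add (a b : Expo) : (a + b).val = a.val + b.val := rfl
lemma val_expo (w : ℂ) : (expo w).val = w := rfl
lemma expo_val (e : Expo) : expo e.val = e := rfl
lemma expo_zero : expo 0 = 0 := rfl
lemma Expo.val_injective : Function.Injective Expo.val :=
  Function.LeftInverse.injective expo_val
lemma Expo.val_eq_zero {e : Expo} : e.val = 0 ↔ e = 0 := by
  rw [← Expo.val_zero]; exact Expo.val_injective.eq_iff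

/-- The exponents of `f` lie in `S`. -/
def SuppIn (S : Set ℂ) (f : FormalRing) : Prop := ∀ e, f.coeff e ≠ 0 → e.val ∈ S

lemma SuppIn.mono {S T : Set ℂ} {f : FormalRing} (h : SuppIn S f) (hST : S ⊆ T) : SuppIn T f :=
  fun e he => hST (h e he)

lemma SuppIn.add {S : Set ℂ} {f g : FormalRing} (hf : SuppIn S f) (hg : SuppIn S g) :
    SuppIn S (f + g) := by
  intro e he
  by_cases h : f.coeff e = 0
  · refine hg e fun h' => he ?_
    rw [HahnSeries.coeff_add, h, h', add_zero]
  · exact hf e h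

lemma SuppIn.zero (S : Set ℂ) : SuppIn S 0 := fun _ he => absurd rfl he

lemma SuppIn.sum {ι : Type*} {S : Set ℂ} (s : Finset ι) (f : ι → FormalRing)
    (h : ∀ i ∈ s, SuppIn S (f i)) : SuppIn S (∑ i ∈ s, f i) :=
  Finset.sum_induction f (SuppIn S) (fun _ _ => SuppIn.add) (SuppIn.zero S) h

lemma SuppIn.mul {S T U : Set ℂ} {f g : FormalRing} (hf : SuppIn S f) (hg : SuppIn T g)
    (h : ∀ a ∈ S, ∀ b ∈ T, a + b ∈ U) : SuppIn U (f * g) := by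
  intro e he
  rw [HahnSeries.coeff_mul] at he
  obtain ⟨⟨a, b⟩, hab, hne⟩ := Finset.exists_ne_zero_of_sum_ne_zero he
  rw [Finset.mem_antidiagonal] at hab
  rw [← hab.2.2, Expo.val_add]
  exact h _ (hf a hab.1) _ (hg b hab.2.1)

lemma suppIn_single {S : Set ℂ} {w : ℂ} (hw : w ∈ S) (a : ℂ) :
    SuppIn S (HahnSeries.single (expo w) a) := by
  intro e he
  have : e = expo w := by
    by_contra h
    exact he (HahnSeries.coeff_single_of_ne h)
  rwa [this, val_expo]

lemma SuppIn.one (Γ : AddSubmonoid ℂ) : SuppIn Γ 1 := suppIn_single (w := 0) Γ.zero_mem 1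

lemma SuppIn.mul_mem {Γ : AddSubmonoid ℂ} {f g : FormalRing} (hf : SuppIn Γ f) (hg : SuppIn Γ g) :
    SuppIn Γ (f * g) := hf.mul hg fun _ ha _ hb => Γ.add_mem ha hb

/-! ### Weighted norms of formal series -/

/-- The norm `∑ |f_e| W(e)`, possibly infinite. -/
def wnorm (W : Expo → ℝ≥0∞) (f : FormalRing) : ℝ≥0∞ := ∑' e, ‖f.coeff e‖ₑ * W e

lemma wnorm_add_le (W : Expo → ℝ≥0∞) (f g : FormalRing) :
    wnorm W (f + g) ≤ wnorm W f + wnorm W g := by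
  rw [wnorm, wnorm, wnorm, ← ENNReal.tsum_add]
  refine ENNReal.tsum_le_tsum fun e => ?_
  rw [HahnSeries.coeff_add, ← add_mul]
  gcongr
  exact enorm_add_le _ _

lemma wnorm_zero (W : Expo → ℝ≥0∞) : wnorm W 0 = 0 := by simp [wnorm]

lemma wnorm_sum_le {ι : Type*} (W : Expo → ℝ≥0∞) (s : Finset ι) (f : ι → FormalRing) :
    wnorm W (∑ i ∈ s, f i) ≤ ∑ i ∈ s, wnorm W (f i) :=
  Finset.le_sum_of_subadditive _ (wnorm_zero W).le (wnorm_add_le W) _ _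

lemma wnorm_mono {S : Set ℂ} {W V : Expo → ℝ≥0∞} {f : FormalRing} (hf : SuppIn S f)
    (h : ∀ e : Expo, e.val ∈ S → W e ≤ V e) : wnorm W f ≤ wnorm V f := by
  refine ENNReal.tsum_le_tsum fun e => ?_
  by_cases he : f.coeff e = 0
  · simp [he]
  · gcongr
    exact h e (hf e he)

lemma enorm_coeff_mul_le (f g : FormalRing) (e : Expo) :
    ‖(f * g).coeff e‖ₑ ≤ ∑' a, ‖f.coeff a‖ₑ * ‖g.coeff (e - a)‖ₑ := by
  classical
  rw [HahnSeries.coeff_mul]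
  refine (enorm_sum_le _ _).trans ?_
  set s := Finset.antidiagonal f.isPWO_support g.isPWO_support e with hs
  have h2 : ∀ ij ∈ s, ij.2 = e - ij.1 := fun ij hij => by
    rw [hs, Finset.mem_antidiagonal] at hij
    rw [← hij.2.2]; abel
  have hinj : Set.InjOn Prod.fst (s : Set (Expo × Expo)) := fun x hx y hy hxy =>
    Prod.ext hxy (by rw [h2 x hx, h2 y hy, hxy])
  calc ∑ ij ∈ s, ‖f.coeff ij.1 * g.coeff ij.2‖ₑ
      = ∑ ij ∈ s, ‖f.coeff ij.1‖ₑ * ‖g.coeff (e - ij.1)‖ₑ :=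
        Finset.sum_congr rfl fun ij hij => by rw [enorm_mul, h2 ij hij]
    _ = ∑ a ∈ s.image Prod.fst, ‖f.coeff a‖ₑ * ‖g.coeff (e - a)‖ₑ :=
        (Finset.sum_image (f := fun a => ‖f.coeff a‖ₑ * ‖g.coeff (e - a)‖ₑ) hinj).symm
    _ ≤ _ := ENNReal.sum_le_tsum _

lemma wnorm_mul_le {S T : Set ℂ} {V W W' : Expo → ℝ≥0∞} {f g : FormalRing}
    (hf : SuppIn S f) (hg : SuppIn T g)
    (h : ∀ a b : Expo, a.val ∈ S → b.val ∈ T → V (a + b) ≤ W a * W' b) :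
    wnorm V (f * g) ≤ wnorm W f * wnorm W' g := by
  calc wnorm V (f * g) ≤ ∑' e, (∑' a, ‖f.coeff a‖ₑ * ‖g.coeff (e - a)‖ₑ) * V e :=
        ENNReal.tsum_le_tsum fun e => by gcongr; exact enorm_coeff_mul_le f g e
    _ = ∑' e, ∑' a, ‖f.coeff a‖ₑ * ‖g.coeff (e - a)‖ₑ * V e := by
        simp_rw [ENNReal.tsum_mul_right]
    _ ≤ ∑' e, ∑' a, ‖f.coeff a‖ₑ * W a * (‖g.coeff (e - a)‖ₑ * W' (e - a)) := by
        refine ENNReal.tsum_le_tsum fun e => ENNReal.tsum_le_tsum fun a => ?_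
        by_cases ha : f.coeff a = 0
        · simp [ha]
        by_cases hb : g.coeff (e - a) = 0
        · simp [hb]
        have := h a (e - a) (hf a ha) (hg _ hb)
        rw [add_sub_cancel] at this
        calc _ ≤ ‖f.coeff a‖ₑ * ‖g.coeff (e - a)‖ₑ * (W a * W' (e - a)) := by gcongr
          _ = _ := by ring
    _ = ∑' a, ∑' e, ‖f.coeff a‖ₑ * W a * (‖g.coeff (e - a)‖ₑ * W' (e - a)) := ENNReal.tsum_comm
    _ = ∑' a, ‖f.coeff a‖ₑ * W a * wnorm W' g := by
        refine tsum_congr fun a => ?_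
        rw [ENNReal.tsum_mul_left]
        congr 1
        exact (Equiv.subRight a).tsum_eq fun e => ‖g.coeff e‖ₑ * W' e
    _ = _ := by rw [ENNReal.tsum_mul_right]; rfl

lemma wnorm_lt_top {W : Expo → ℝ≥0∞} {f : FormalRing} (hf : f.support.Finite)
    (hW : ∀ e, W e ≠ ∞) : wnorm W f < ∞ := by
  rw [wnorm, tsum_eq_sum (s := hf.toFinset) (fun e he => by
    have : f.coeff e = 0 := by simpa using he
    simp [this])]
  exact ENNReal.sum_lt_top.mpr fun e _ => ENNReal.mul_lt_top (by simp) (lt_top_iff_ne_top.mpr (hW e))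

/-! ### The majorant argument -/

/-- The nonzero elements of a monoid of exponents. -/
def nonzeroPart (Γ : AddSubmonoid ℂ) : Set ℂ := {g | g ∈ Γ ∧ g ≠ 0}

lemma nonzeroPart_subset (Γ : AddSubmonoid ℂ) : nonzeroPart Γ ⊆ Γ := fun _ h => h.1

lemma add_mem_nonzeroPart {Γ : AddSubmonoid ℂ} (hpos : ∀ g ∈ Γ, g ≠ 0 → 0 < g.re) {a b : ℂ}
    (ha : a ∈ Γ) (hb : b ∈ nonzeroPart Γ) : a + b ∈ nonzeroPart Γ := by
  refine ⟨add_mem ha hb.1, fun h => ?_⟩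
  have h' := congrArg Complex.re h
  simp only [Complex.add_re, Complex.zero_re] at h'
  have h1 := hpos b hb.1 hb.2
  by_cases h0 : a = 0
  · simp [h0] at h'; linarith
  · linarith [hpos a ha h0]

lemma exists_eq_single_add {ι : Type*} {d : ι →₀ ℕ} (hd : d ≠ 0) :
    ∃ i d', d = Finsupp.single i 1 + d' := by
  obtain ⟨i, hi⟩ := Finsupp.ne_iff.mp hd
  refine ⟨i, d - Finsupp.single i 1, ?_⟩
  rw [add_tsub_cancel_of_le]
  rw [Finsupp.single_le_iff]
  exact Nat.one_le_iff_ne_zero.mpr hi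

lemma prod_pow_single_add {ι R : Type*} [Fintype ι] [CommMonoid R] (U : ι → R) (i : ι)
    (d : ι →₀ ℕ) : ∏ k, U k ^ (Finsupp.single i 1 + d : ι →₀ ℕ) k = U i * ∏ k, U k ^ d k := by
  classical
  simp only [Finsupp.add_apply, pow_add, Finset.prod_mul_distrib]
  congr 1
  rw [Finset.prod_eq_single i]
  · simp
  · intro b _ hb
    simp [hb.symm]
  · simp

lemma suppIn_prod_pow {ι : Type*} [Fintype ι] (Γ : AddSubmonoid ℂ) (U : ι → FormalRing)
    (hU : ∀ k, SuppIn Γ (U k)) (d : ι →₀ ℕ) : SuppIn Γ (∏ k, U k ^ d k) := by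
  refine Finset.prod_induction _ (SuppIn Γ) (fun _ _ => SuppIn.mul_mem) (SuppIn.one Γ) ?_
  intro k _
  induction d k with
  | zero => rw [pow_zero]; exact SuppIn.one Γ
  | succ m ih => rw [pow_succ]; exact ih.mul_mem (hU k)

lemma suppIn_prod_pow_nonzeroPart {ι : Type*} [Fintype ι] {Γ : AddSubmonoid ℂ}
    (hpos : ∀ g ∈ Γ, g ≠ 0 → 0 < g.re) (U : ι → FormalRing)
    (hU : ∀ k, SuppIn (nonzeroPart Γ) (U k)) {d : ι →₀ ℕ} (hd : d ≠ 0) :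
    SuppIn (nonzeroPart Γ) (∏ k, U k ^ d k) := by
  obtain ⟨i, d', rfl⟩ := exists_eq_single_add hd
  rw [prod_pow_single_add, mul_comm]
  exact (suppIn_prod_pow Γ U (fun k => (hU k).mono (nonzeroPart_subset Γ)) d').mul (hU i)
    fun a ha b hb => add_mem_nonzeroPart hpos ha hb

/-- The weight `r ^ {Re e} exp(-P(e))`, cut off where the real part exceeds `R`. -/
def cutWeight (P : ℂ → ℝ) (r R : ℝ) (e : Expo) : ℝ≥0∞ :=
  if e.val.re ≤ R then ENNReal.ofReal (r ^ e.val.re * Real.exp (-P e.val)) else 0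

lemma cutWeight_of_le {P : ℂ → ℝ} {r R : ℝ} {e : Expo} (h : e.val.re ≤ R) :
    cutWeight P r R e = ENNReal.ofReal (r ^ e.val.re * Real.exp (-P e.val)) := if_pos h

lemma cutWeight_of_not_le {P : ℂ → ℝ} {r R : ℝ} {e : Expo} (h : ¬ e.val.re ≤ R) :
    cutWeight P r R e = 0 := if_neg h

/-- The majorant argument: if the coefficients of `U_k` are bounded by those of `Q(U)`, up to the
factor `exp T`, and if `Q` has no constant coefficients in degrees zero and one, then the `U_k` have
finite norms for a weight `r ^ {Re e} exp (-P(e))`. -/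
theorem exists_wnorm_lt_top {n : ℕ} (Γ : AddSubmonoid ℂ) (w₀ : ℝ) (hw₀ : 0 < w₀)
    (hΓ : ∀ g ∈ Γ, g ≠ 0 → w₀ ≤ g.re) (P T : ℂ → ℝ) (hP : ∀ g ∈ Γ, 0 ≤ P g)
    (hT : ∀ g ∈ Γ, 0 ≤ T g) (hTP : ∀ g ∈ Γ, g ≠ 0 → T g ≤ P g)
    (hadd : ∀ b ∈ Γ, ∀ d ∈ Γ, b ≠ 0 → d ≠ 0 → P b + P d + T (b + d) ≤ P (b + d))
    (U : Fin (n + 1) → FormalRing) (hU : ∀ k, SuppIn (nonzeroPart Γ) (U k))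
    (Q : MvPolynomial (Fin (n + 1)) FormalRing) (hQ : ∀ d, SuppIn Γ (Q.coeff d))
    (hQfin : ∀ d, (Q.coeff d).support.Finite)
    (hQ1 : ∀ d : Fin (n + 1) →₀ ℕ, d.degree ≤ 1 → SuppIn (nonzeroPart Γ) (Q.coeff d))
    (C : ℝ) (hC : ∀ k (e : Expo), e.val ∈ nonzeroPart Γ →
      ‖(U k).coeff e‖ ≤ C * (Real.exp (T e.val) * ‖(MvPolynomial.eval U Q).coeff e‖)) :
    ∃ r : ℝ, 0 < r ∧ ∀ k,
      wnorm (fun e => ENNReal.ofReal (r ^ e.val.re * Real.exp (-P e.val))) (U k) < ∞ := by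
  have hpos : ∀ g ∈ Γ, g ≠ 0 → 0 < g.re := fun g hg h => hw₀.trans_le (hΓ g hg h)
  have hnn : ∀ g ∈ Γ, 0 ≤ g.re := fun g hg => by
    by_cases h : g = 0
    · simp [h]
    · exact (hpos g hg h).le
  set M : ℝ≥0∞ := ∑ d ∈ Q.support, wnorm 1 (Q.coeff d) with hM
  have hMtop : M < ∞ := ENNReal.sum_lt_top.mpr fun d _ =>
    wnorm_lt_top (hQfin d) (fun _ => ENNReal.one_ne_top)
  set A : ℝ := (ENNReal.ofReal C * M).toReal with hA
  have hA0 : 0 ≤ A := ENNReal.toReal_nonneg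
  have hAM : ENNReal.ofReal C * M = ENNReal.ofReal A :=
    (ENNReal.ofReal_toReal (ENNReal.mul_lt_top ENNReal.ofReal_lt_top hMtop).ne).symm
  -- the bound `η` reproduces itself: `Q(U)` is at most `M (r ^ w₀ + η ^ 2)`, and `r ^ w₀ = η ^ 2`
  set η : ℝ := 1 / (2 * A + 1) with hη
  have hη0 : 0 < η := by positivity
  have hη1 : η ≤ 1 := by rw [hη, div_le_one (by positivity)]; linarith
  have hAη : A * (η ^ 2 + η ^ 2) ≤ η := by
    have : 2 * A * η ≤ 1 := by rw [hη, mul_one_div, div_le_one (by positivity)]; linarith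
    nlinarith
  set r : ℝ := (η ^ 2) ^ w₀⁻¹ with hr
  have hr0 : 0 < r := by positivity
  have hr1 : r ≤ 1 := Real.rpow_le_one (by positivity) (pow_le_one₀ hη0.le hη1) (by positivity)
  have hrw : r ^ w₀ = η ^ 2 := Real.rpow_inv_rpow (by positivity) hw₀.ne'
  refine ⟨r, hr0, ?_⟩
  let V : ℝ → Expo → ℝ≥0∞ := fun R e => cutWeight P r R e * ENNReal.ofReal (Real.exp (T e.val))
  have hrpow : ∀ g ∈ nonzeroPart Γ, r ^ g.re ≤ η ^ 2 := fun g hg => by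
    rw [← hrw]; exact Real.rpow_le_rpow_of_exponent_ge hr0 hr1 (hΓ g hg.1 hg.2)
  have hW1 : ∀ R (e : Expo), e.val ∈ Γ → cutWeight P r R e ≤ 1 := by
    intro R e he
    unfold cutWeight
    split_ifs
    · rw [ENNReal.ofReal_le_one]
      exact mul_le_one₀ (Real.rpow_le_one hr0.le hr1 (hnn _ he)) (Real.exp_pos _).le
        (Real.exp_le_one_iff.mpr (by linarith [hP _ he]))
    · exact zero_le
  have hV1 : ∀ R (e : Expo), e.val ∈ nonzeroPart Γ → V R e ≤ ENNReal.ofReal (η ^ 2) := by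
    intro R e he
    simp only [V, cutWeight]
    split_ifs
    · rw [← ENNReal.ofReal_mul (by positivity), mul_assoc, ← Real.exp_add]
      refine ENNReal.ofReal_le_ofReal ?_
      calc _ ≤ r ^ e.val.re * 1 := by
            gcongr
            exact Real.exp_le_one_iff.mpr (by linarith [hTP _ he.1 he.2])
        _ ≤ _ := by rw [mul_one]; exact hrpow _ he
    · simp
  have hW2 : ∀ R (e : Expo), e.val ∈ nonzeroPart Γ → cutWeight P r R e ≤ ENNReal.ofReal (η ^ 2) :=
    fun R e he => le_trans (le_mul_of_one_le_right (zero_le) (by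
      rw [ENNReal.one_le_ofReal]; exact Real.one_le_exp (hT _ he.1))) (hV1 R e he)
  -- every factor of a product has a real part that is smaller by at least `w₀`
  have hVadd : ∀ R (a b : Expo), a.val ∈ nonzeroPart Γ → b.val ∈ nonzeroPart Γ →
      V (R + w₀) (a + b) ≤ cutWeight P r R a * cutWeight P r R b := by
    intro R a b ha hb
    simp only [V]
    by_cases h : (a + b).val.re ≤ R + w₀
    · have h' := h
      rw [Expo.val_add, Complex.add_re] at h'
      rw [cutWeight_of_le h, cutWeight_of_le (e := a) (by linarith [hΓ _ hb.1 hb.2]),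
        cutWeight_of_le (e := b) (by linarith [hΓ _ ha.1 ha.2]),
        ← ENNReal.ofReal_mul (by positivity), ← ENNReal.ofReal_mul (by positivity)]
      refine ENNReal.ofReal_le_ofReal ?_
      rw [Expo.val_add, Complex.add_re, Real.rpow_add hr0]
      calc _ = r ^ a.val.re * r ^ b.val.re *
            Real.exp (-P (a.val + b.val) + T (a.val + b.val)) := by rw [Real.exp_add]; ring
        _ ≤ r ^ a.val.re * r ^ b.val.re * Real.exp (-P a.val + -P b.val) := by
            refine mul_le_mul_of_nonneg_left (Real.exp_le_exp.mpr ?_) (by positivity)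
            linarith [hadd _ ha.1 _ hb.1 ha.2 hb.2]
        _ = _ := by rw [Real.exp_add]; ring
    · rw [cutWeight_of_not_le h, zero_mul]; exact zero_le
  have hWadd : ∀ R (a b : Expo), a.val ∈ nonzeroPart Γ → b.val ∈ nonzeroPart Γ →
      cutWeight P r R (a + b) ≤ cutWeight P r R a * cutWeight P r R b := by
    intro R a b ha hb
    by_cases h : (a + b).val.re ≤ R
    · have h' := h
      rw [Expo.val_add, Complex.add_re] at h'
      rw [cutWeight_of_le h, cutWeight_of_le (e := a) (by linarith [hpos _ hb.1 hb.2]),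
        cutWeight_of_le (e := b) (by linarith [hpos _ ha.1 ha.2]),
        ← ENNReal.ofReal_mul (by positivity)]
      refine ENNReal.ofReal_le_ofReal ?_
      rw [Expo.val_add, Complex.add_re, Real.rpow_add hr0]
      calc _ ≤ r ^ a.val.re * r ^ b.val.re * Real.exp (-P a.val + -P b.val) := by
            gcongr
            linarith [hadd _ ha.1 _ hb.1 ha.2 hb.2, hT _ (add_mem ha.1 hb.1)]
        _ = _ := by rw [Real.exp_add]; ring
    · rw [cutWeight_of_not_le h]; exact zero_le
  have hUΓ : ∀ k, SuppIn Γ (U k) := fun k => (hU k).mono (nonzeroPart_subset Γ)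
  have hηE : ENNReal.ofReal η ≤ 1 := by rw [ENNReal.ofReal_le_one]; exact hη1
  -- products of the unknown functions
  have hprod : ∀ R, (∀ k, wnorm (cutWeight P r R) (U k) ≤ ENNReal.ofReal η) →
      ∀ (m : ℕ) (d : Fin (n + 1) →₀ ℕ), d.degree = m + 1 →
        wnorm (cutWeight P r R) (∏ k, U k ^ d k) ≤ ENNReal.ofReal η := by
    intro R hR m
    induction m with
    | zero =>
      intro d hd
      obtain ⟨i, d', rfl⟩ := exists_eq_single_add (d := d) (by rintro rfl; simp at hd)
      have hd' : d' = 0 := by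
        rw [← Finsupp.degree_eq_zero_iff]
        rw [map_add, Finsupp.degree_single] at hd
        omega
      rw [prod_pow_single_add, hd']
      simpa using hR i
    | succ m ih =>
      intro d hd
      obtain ⟨i, d', rfl⟩ := exists_eq_single_add (d := d) (by rintro rfl; simp at hd)
      have hd' : d'.degree = m + 1 := by
        rw [map_add, Finsupp.degree_single] at hd
        omega
      rw [prod_pow_single_add]
      calc _ ≤ _ := wnorm_mul_le (hU i) (suppIn_prod_pow_nonzeroPart hpos U hU
              (d := d') (by rintro rfl; simp at hd')) (hWadd R)
        _ ≤ ENNReal.ofReal η * ENNReal.ofReal η := mul_le_mul' (hR i) (ih d' hd')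
        _ ≤ _ := mul_le_of_le_one_right' hηE
  have hterm : ∀ R, (∀ k, wnorm (cutWeight P r R) (U k) ≤ ENNReal.ofReal η) →
      ∀ d : Fin (n + 1) →₀ ℕ, wnorm (V (R + w₀)) (Q.coeff d * ∏ k, U k ^ d k) ≤
        ENNReal.ofReal (η ^ 2 + η ^ 2) * wnorm 1 (Q.coeff d) := by
    intro R hR d
    have hη2 : ENNReal.ofReal (η ^ 2) ≤ ENNReal.ofReal (η ^ 2 + η ^ 2) :=
      ENNReal.ofReal_le_ofReal (by linarith [sq_nonneg η])
    have hsmall : ∀ W : Expo → ℝ≥0∞, (∀ e : Expo, e.val ∈ nonzeroPart Γ →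
        W e ≤ ENNReal.ofReal (η ^ 2)) → SuppIn (nonzeroPart Γ) (Q.coeff d) →
        wnorm W (Q.coeff d) ≤ ENNReal.ofReal (η ^ 2) * wnorm 1 (Q.coeff d) := by
      intro W hW hd
      rw [wnorm, wnorm, ← ENNReal.tsum_mul_left]
      refine ENNReal.tsum_le_tsum fun e => ?_
      by_cases he : (Q.coeff d).coeff e = 0
      · simp [he]
      · rw [Pi.one_apply, mul_one, mul_comm]
        gcongr
        exact hW e (hd e he)
    rcases Nat.lt_or_ge d.degree 2 with h2 | h2
    · have hd1 := hQ1 d (by omega)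
      by_cases hd0 : d = 0
      · subst hd0
        simp only [Finsupp.coe_zero, Pi.zero_apply, pow_zero, Finset.prod_const_one, mul_one]
        exact (hsmall _ (hV1 _) hd1).trans (by gcongr)
      · have hdeg : d.degree = 0 + 1 := by
          have : d.degree ≠ 0 := fun h => hd0 ((Finsupp.degree_eq_zero_iff d).mp h)
          omega
        calc _ ≤ _ := wnorm_mul_le hd1 (suppIn_prod_pow_nonzeroPart hpos U hU hd0) (hVadd R)
          _ ≤ (ENNReal.ofReal (η ^ 2) * wnorm 1 (Q.coeff d)) * 1 :=
            mul_le_mul' (hsmall _ (hW2 R) hd1) ((hprod R hR 0 d hdeg).trans hηE)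
          _ ≤ _ := by rw [mul_one]; gcongr
    · obtain ⟨i, d', rfl⟩ := exists_eq_single_add (d := d) (by rintro rfl; simp at h2)
      obtain ⟨m, hm⟩ : ∃ m, d'.degree = m + 1 := by
        rw [map_add, Finsupp.degree_single] at h2
        exact ⟨d'.degree - 1, by omega⟩
      have hd' : d' ≠ 0 := by rintro rfl; simp at hm
      have hs := suppIn_prod_pow_nonzeroPart hpos U hU hd'
      have hQd := hQ (Finsupp.single i 1 + d')
      rw [prod_pow_single_add, mul_left_comm]
      calc _ ≤ _ := wnorm_mul_le (hU i) (hQd.mul hs fun a ha b hb =>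
              add_mem_nonzeroPart hpos ha hb) (hVadd R)
        _ ≤ ENNReal.ofReal η *
            (wnorm 1 (Q.coeff (Finsupp.single i 1 + d')) * ENNReal.ofReal η) := by
            refine mul_le_mul' (hR i) (le_trans (wnorm_mul_le (W := 1) hQd hs ?_)
              (mul_le_mul' le_rfl (hprod R hR m d' hm)))
            intro a b ha hb
            rw [Pi.one_apply, one_mul]
            by_cases ha0 : a.val = 0
            · rw [Expo.val_eq_zero.mp ha0, zero_add]
            · calc _ ≤ _ := hWadd R a b ⟨ha, ha0⟩ hb
                _ ≤ _ := mul_le_of_le_one_left' (hW1 R a ha)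
        _ = ENNReal.ofReal (η ^ 2) * wnorm 1 (Q.coeff (Finsupp.single i 1 + d')) := by
            rw [sq, ENNReal.ofReal_mul hη0.le]; ring
        _ ≤ _ := by gcongr
  have hind : ∀ j : ℕ, ∀ k, wnorm (cutWeight P r (j * w₀)) (U k) ≤ ENNReal.ofReal η := by
    intro j
    induction j with
    | zero =>
      intro k
      refine le_trans (wnorm_mono (V := 0) (hU k) fun e he => ?_) (by simp [wnorm])
      rw [cutWeight, if_neg]
      · exact zero_le
      · push_cast
        linarith [hpos _ he.1 he.2]
    | succ j ih =>
      intro k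
      have hR : ((j + 1 : ℕ) : ℝ) * w₀ = j * w₀ + w₀ := by push_cast; ring
      rw [hR]
      have h1 : wnorm (V (j * w₀ + w₀)) (MvPolynomial.eval U Q) ≤
          ENNReal.ofReal (η ^ 2 + η ^ 2) * M := by
        rw [MvPolynomial.eval_eq']
        refine (wnorm_sum_le _ _ _).trans ?_
        rw [hM, Finset.mul_sum]
        exact Finset.sum_le_sum fun d _ => hterm _ ih d
      calc wnorm (cutWeight P r (j * w₀ + w₀)) (U k)
          ≤ ENNReal.ofReal C * wnorm (V (j * w₀ + w₀)) (MvPolynomial.eval U Q) := by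
            rw [wnorm, wnorm, ← ENNReal.tsum_mul_left]
            refine ENNReal.tsum_le_tsum fun e => ?_
            by_cases he : (U k).coeff e = 0
            · simp [he]
            have h2 := ENNReal.ofReal_le_ofReal (hC k e (hU k e he))
            rw [ENNReal.ofReal_mul' (by positivity), ENNReal.ofReal_mul (Real.exp_pos _).le,
              ofReal_norm, ofReal_norm] at h2
            calc _ ≤ _ := mul_le_mul' h2 le_rfl
              _ = _ := by ring
        _ ≤ ENNReal.ofReal C * (ENNReal.ofReal (η ^ 2 + η ^ 2) * M) := by gcongr
        _ = ENNReal.ofReal C * M * ENNReal.ofReal (η ^ 2 + η ^ 2) := by ring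
        _ = ENNReal.ofReal (A * (η ^ 2 + η ^ 2)) := by rw [hAM, ENNReal.ofReal_mul hA0]
        _ ≤ _ := ENNReal.ofReal_le_ofReal hAη
  intro k
  refine lt_of_le_of_lt ?_ (ENNReal.ofReal_lt_top (r := η))
  rw [wnorm, ENNReal.tsum_eq_iSup_sum]
  refine iSup_le fun s => ?_
  obtain ⟨B, hB⟩ := (s.image fun e => e.val.re).bddAbove
  obtain ⟨j, hj⟩ := exists_nat_ge (B / w₀)
  rw [div_le_iff₀ hw₀] at hj
  refine le_trans (le_trans (Finset.sum_le_sum fun e he => ?_)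
    (ENNReal.sum_le_tsum (f := fun e => ‖(U k).coeff e‖ₑ * cutWeight P r (j * w₀) e) s)) (hind j k)
  rw [cutWeight, if_pos]
  exact (hB (Finset.mem_coe.mpr (Finset.mem_image_of_mem _ he))).trans hj

/-- As the potential is at most linear, it only shrinks the radius. -/
lemma summable_of_wnorm_lt_top {Γ : AddSubmonoid ℂ} {P : ℂ → ℝ} {K r : ℝ} (hr : 0 < r)
    (hP : ∀ g ∈ Γ, P g ≤ K * g.re) {f : FormalRing} (hf : SuppIn Γ f)
    (h : wnorm (fun e => ENNReal.ofReal (r ^ e.val.re * Real.exp (-P e.val))) f < ∞) :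
    Summable fun e => ‖f.coeff e‖ * (r * Real.exp (-K)) ^ e.val.re := by
  refine Summable.of_nonneg_of_le (fun e => by positivity) (fun e => ?_)
    (ENNReal.summable_toReal h.ne)
  rw [ENNReal.toReal_mul, toReal_enorm, ENNReal.toReal_ofReal (by positivity)]
  by_cases he : f.coeff e = 0
  · simp [he]
  · rw [Real.mul_rpow hr.le (Real.exp_pos _).le, ← Real.exp_mul]
    gcongr
    linarith [hP _ (hf e he)]

/-! ### Convergence in sectors -/

/-- The branch of the logarithm with argument in `(θ, θ + 2π]`, obtained by a rotation from the
principal branch, whose differentiability is known. -/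
def logFrom (θ : ℝ) (z : ℂ) : ℂ :=
  Complex.log (z * Complex.exp (-((θ + Real.pi : ℝ) * Complex.I))) + (θ + Real.pi : ℝ) * Complex.I

lemma argFrom_mem (θ : ℝ) (z : ℂ) : argFrom θ z ∈ Set.Ioc θ (θ + 2 * Real.pi) :=
  toIocMod_mem_Ioc _ _ _

lemma exp_log_add_argFrom (θ : ℝ) {z : ℂ} (hz : z ≠ 0) :
    Complex.exp (Real.log ‖z‖ + argFrom θ z * Complex.I) = z := by
  have h : argFrom θ z = Complex.arg z - toIocDiv Real.two_pi_pos θ (Complex.arg z) *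
      (2 * Real.pi) := by
    rw [argFrom, ← self_sub_toIocDiv_zsmul, zsmul_eq_mul]
  conv_rhs => rw [← Complex.exp_log hz]
  rw [Complex.exp_eq_exp_iff_exists_int]
  refine ⟨-toIocDiv Real.two_pi_pos θ (Complex.arg z), ?_⟩
  rw [Complex.log, h]
  push_cast
  ring

lemma log_rotate (θ : ℝ) {z : ℂ} (hz : z ≠ 0) :
    Complex.log (z * Complex.exp (-((θ + Real.pi : ℝ) * Complex.I))) =
      Real.log ‖z‖ + (argFrom θ z - (θ + Real.pi) : ℝ) * Complex.I := by
  have hm := argFrom_mem θ z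
  conv_lhs => rw [← exp_log_add_argFrom θ hz]
  rw [← Complex.exp_add]
  have him : ((Real.log ‖z‖ : ℂ) + argFrom θ z * Complex.I +
      -((θ + Real.pi : ℝ) * Complex.I)).im = argFrom θ z - (θ + Real.pi) := by simp; ring
  rw [Complex.log_exp (by rw [him]; linarith [hm.1]) (by rw [him]; linarith [hm.2])]
  push_cast
  ring

lemma logFrom_eq (θ : ℝ) {z : ℂ} (hz : z ≠ 0) :
    logFrom θ z = Real.log ‖z‖ + argFrom θ z * Complex.I := by
  rw [logFrom, log_rotate θ hz]
  push_cast
  ring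

lemma argFrom_eq_arg_add (θ : ℝ) {z : ℂ} (hz : z ≠ 0) :
    argFrom θ z =
      Complex.arg (z * Complex.exp (-((θ + Real.pi : ℝ) * Complex.I))) + (θ + Real.pi) := by
  have h := congrArg Complex.im (log_rotate θ hz)
  rw [Complex.log_im] at h
  rw [h]
  simp

lemma rotate_mem_slitPlane (θ₁ θ₂ : ℝ) (h : θ₂ - θ₁ < 2 * Real.pi) {z : ℂ} (hz : z ≠ 0)
    (hz2 : argFrom θ₁ z < θ₂) :
    z * Complex.exp (-((θ₁ + Real.pi : ℝ) * Complex.I)) ∈ Complex.slitPlane := by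
  rw [Complex.mem_slitPlane_iff_arg]
  refine ⟨?_, mul_ne_zero hz (Complex.exp_ne_zero _)⟩
  rw [argFrom_eq_arg_add θ₁ hz] at hz2
  intro h'
  rw [h'] at hz2
  linarith

lemma isOpen_sector (r θ₁ θ₂ : ℝ) (h : θ₂ - θ₁ < 2 * Real.pi) : IsOpen (sector r θ₁ θ₂) := by
  rw [isOpen_iff_mem_nhds]
  rintro z ⟨hz, hzr, hz2⟩
  have hc : ContinuousAt (fun z => Complex.arg (z * Complex.exp (-((θ₁ + Real.pi : ℝ) * Complex.I)))
      + (θ₁ + Real.pi)) z :=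
    ((Complex.continuousAt_arg (rotate_mem_slitPlane θ₁ θ₂ h hz hz2)).comp
      (f := fun z => z * Complex.exp (-((θ₁ + Real.pi : ℝ) * Complex.I)))
      (by fun_prop)).add continuousAt_const
  have h1 := hc.eventually (Iio_mem_nhds ((argFrom_eq_arg_add θ₁ hz).symm.trans_lt hz2))
  have h2 : ∀ᶠ y in 𝓝 z, y ≠ 0 := isOpen_ne.mem_nhds hz
  have h3 : ∀ᶠ y : ℂ in 𝓝 z, ‖y‖ < r := (isOpen_lt continuous_norm continuous_const).mem_nhds hzr
  filter_upwards [h1, h2, h3] with y hy1 hy2 hy3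
  exact ⟨hy2, hy3, by rwa [argFrom_eq_arg_add θ₁ hy2]⟩

lemma differentiableOn_powFrom (r θ₁ θ₂ : ℝ) (h : θ₂ - θ₁ < 2 * Real.pi) (w : ℂ) :
    DifferentiableOn ℂ (fun z => powFrom θ₁ z w) (sector r θ₁ θ₂) := by
  have h1 : DifferentiableOn ℂ (fun z => Complex.exp (w * logFrom θ₁ z)) (sector r θ₁ θ₂) := by
    intro z hz
    refine DifferentiableAt.differentiableWithinAt ?_
    unfold logFrom
    have := rotate_mem_slitPlane θ₁ θ₂ h hz.1 hz.2.2
    exact ((((differentiableAt_id.mul_const _).clog this).add_const _).const_mul w).cexp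
  refine h1.congr fun z hz => ?_
  rw [powFrom, logFrom_eq θ₁ hz.1]

lemma norm_powFrom (θ : ℝ) {z : ℂ} (hz : z ≠ 0) (w : ℂ) :
    ‖powFrom θ z w‖ = ‖z‖ ^ w.re * Real.exp (-(w.im * argFrom θ z)) := by
  have h : (w * (Real.log ‖z‖ + argFrom θ z * Complex.I)).re =
      Real.log ‖z‖ * w.re + -(w.im * argFrom θ z) := by
    simp; ring
  rw [powFrom, Complex.norm_exp, h, Real.exp_add, Real.rpow_def_of_pos (norm_pos_iff.mpr hz)]

/-- If the exponents of `φ` differ from `λ` by vectors in a proper cone around the positive axis,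
up to finitely many, then absolute convergence along the positive axis gives convergence in
sectors. -/
theorem GenPowerSeries.hasNonzeroRadius_of_summable (φ : GenPowerSeries) (lam : ℂ) (J : ℕ) (B : ℝ)
    (hB : ∀ j, J < j → φ.c j ≠ 0 → |(φ.lam j - lam).im| ≤ B * (φ.lam j - lam).re)
    (ρ : ℝ) (hρ : 0 < ρ)
    (hsum : Summable fun j => if J < j then ‖φ.c j‖ * ρ ^ (φ.lam j - lam).re else 0) :
    φ.HasNonzeroRadius := by
  intro θ₁ θ₂ _ h
  set Θ : ℝ := max |θ₁| |θ₂| with hΘ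
  have hΘ0 : 0 ≤ Θ := (abs_nonneg _).trans (le_max_left _ _)
  set r : ℝ := ρ * Real.exp (-(B * Θ)) with hr
  have hr0 : 0 < r := by positivity
  have hu : TendstoUniformlyOn
      (fun (s : Finset ℕ) z => ∑ j ∈ s, φ.c j * powFrom θ₁ z (φ.lam j))
      (fun z => ∑' j, φ.c j * powFrom θ₁ z (φ.lam j)) atTop (sector r θ₁ θ₂) := by
    refine tendstoUniformlyOn_tsum_of_cofinite_eventually
      (hsum.mul_left (r ^ lam.re * Real.exp (|lam.im| * Θ))) ?_
    rw [Nat.cofinite_eq_atTop]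
    filter_upwards [φ.re_tendsto.eventually_ge_atTop 0, eventually_gt_atTop J] with j hj hJ z hz
    rw [if_pos hJ]
    by_cases hc : φ.c j = 0
    · simp [hc]
    have hz0 : 0 < ‖z‖ := norm_pos_iff.mpr hz.1
    have harg : |argFrom θ₁ z| ≤ Θ := by
      have h1 := (argFrom_mem θ₁ z).1
      have h2 := hz.2.2
      rw [abs_le]
      constructor
      · linarith [neg_abs_le θ₁, le_max_left |θ₁| |θ₂|]
      · linarith [le_abs_self θ₂, le_max_right |θ₁| |θ₂|]
    set g := φ.lam j - lam with hg
    have hlam : φ.lam j = lam + g := by rw [hg]; ring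
    have hBg := hB j hJ hc
    have hexp : -((φ.lam j).im * argFrom θ₁ z) ≤ |lam.im| * Θ + B * g.re * Θ := by
      calc -((φ.lam j).im * argFrom θ₁ z) ≤ |(φ.lam j).im| * |argFrom θ₁ z| := by
            rw [← abs_mul]; exact neg_le_abs _
        _ ≤ (|lam.im| + B * g.re) * Θ := by
            have : |(φ.lam j).im| ≤ |lam.im| + B * g.re := by
              rw [hlam, Complex.add_im]
              exact (abs_add_le _ _).trans (by linarith)
            gcongr
            exact (abs_nonneg _).trans this
        _ = _ := by ring
    rw [norm_mul, norm_powFrom θ₁ hz.1]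
    calc ‖φ.c j‖ * (‖z‖ ^ (φ.lam j).re * Real.exp (-((φ.lam j).im * argFrom θ₁ z)))
        ≤ ‖φ.c j‖ * (r ^ (φ.lam j).re * Real.exp (|lam.im| * Θ + B * g.re * Θ)) := by
          gcongr
          exact hz.2.1.le
      _ = _ := by
          rw [hlam, Complex.add_re, Real.rpow_add hr0, Real.exp_add, hr,
            Real.mul_rpow (z := g.re) hρ.le (Real.exp_pos _).le, ← Real.exp_mul,
            show -(B * Θ) * g.re = -(B * g.re * Θ) by ring, Real.exp_neg (B * g.re * Θ)]
          field_simp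
  refine ⟨r, hr0, _, hu, ?_⟩
  refine hu.tendstoLocallyUniformlyOn.differentiableOn ?_ (isOpen_sector r θ₁ θ₂ h)
  refine Eventually.of_forall fun s => ?_
  exact DifferentiableOn.fun_sum fun j _ => (differentiableOn_powFrom r θ₁ θ₂ h _).const_mul _

/-! ### The dilatation operator and the change of variable -/

lemma qpow_add (q a b : ℂ) : qpow q (a + b) = qpow q a * qpow q b := by
  rw [qpow, add_mul, Complex.exp_add]; rfl

lemma qpow_zero (q : ℂ) : qpow q 0 = 1 := by simp [qpow]

lemma qpow_ne_zero (q w : ℂ) : qpow q w ≠ 0 := Complex.exp_ne_zero _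

lemma coeff_sigma (q : ℂ) (f : FormalRing) (e : Expo) :
    (sigma q f).coeff e = qpow q e.val * f.coeff e := rfl

/-- The dilatation operator as a ring homomorphism. -/
def sigmaHom (q : ℂ) : FormalRing →+* FormalRing where
  toFun := sigma q
  map_zero' := by ext e; simp [coeff_sigma]
  map_one' := by
    ext e
    rw [coeff_sigma, HahnSeries.coeff_one]
    split_ifs with h
    · rw [h, Expo.val_zero, qpow_zero, one_mul]
    · rw [mul_zero]
  map_add' f g := by ext e; simp [coeff_sigma, mul_add]
  map_mul' f g := by
    ext e
    rw [coeff_sigma, HahnSeries.coeff_mul, HahnSeries.coeff_mul, Finset.mul_sum]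
    refine Finset.sum_congr ?_ ?_
    · ext ⟨a, b⟩
      simp [Finset.mem_antidiagonal, coeff_sigma, qpow_ne_zero]
    · rintro ⟨a, b⟩ hab
      rw [Finset.mem_antidiagonal] at hab
      rw [← hab.2.2, Expo.val_add, qpow_add, coeff_sigma, coeff_sigma]
      ring

lemma sigma_iterate_add (q : ℂ) (k : ℕ) (f g : FormalRing) :
    (sigma q)^[k] (f + g) = (sigma q)^[k] f + (sigma q)^[k] g :=
  iterate_map_add (sigmaHom q) k f g

lemma sigma_iterate_mul (q : ℂ) (k : ℕ) (f g : FormalRing) :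
    (sigma q)^[k] (f * g) = (sigma q)^[k] f * (sigma q)^[k] g :=
  iterate_map_mul (sigmaHom q) k f g

lemma coeff_sigma_iterate (q : ℂ) (k : ℕ) (f : FormalRing) (e : Expo) :
    ((sigma q)^[k] f).coeff e = qpow q e.val ^ k * f.coeff e := by
  induction k with
  | zero => simp
  | succ k ih => rw [Function.iterate_succ_apply', coeff_sigma, ih, pow_succ']; ring

lemma sigma_iterate_mono (q : ℂ) (k : ℕ) (w : ℂ) :
    (sigma q)^[k] (mono w 1) = mono w (qpow q w ^ k) := by
  ext e
  rw [coeff_sigma_iterate, mono, mono]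
  by_cases h : e = expo w
  · rw [h, HahnSeries.coeff_single_same, HahnSeries.coeff_single_same, val_expo, mul_one]
  · rw [HahnSeries.coeff_single_of_ne h, HahnSeries.coeff_single_of_ne h, mul_zero]

lemma SuppIn.sigma_iterate {S : Set ℂ} {f : FormalRing} (hf : SuppIn S f) (q : ℂ) (k : ℕ) :
    SuppIn S ((sigma q)^[k] f) := fun e he => hf e fun h => he (by
  rw [coeff_sigma_iterate, h, mul_zero])

lemma eval_shifted {n : ℕ} (q : ℂ) (F : QPoly n) (g f : FormalRing) (w : ℂ) :
    MvPolynomial.eval (fun k : Fin (n + 1) => (sigma q)^[k] f) (shifted q F g w) =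
      substSeries q F (g + mono w 1 * f) := by
  rw [shifted, substSeries, MvPolynomial.hom_eval₂]
  congr 1
  · ext <;> simp
  · funext k
    simp [sigma_iterate_add, sigma_iterate_mul]

/-- The chain rule for the change of variable. -/
lemma pderiv_shifted {n : ℕ} (q : ℂ) (F : QPoly n) (g : FormalRing) (w : ℂ) (k : Fin (n + 1)) :
    MvPolynomial.pderiv k (shifted q F g w) =
      MvPolynomial.C ((sigma q)^[k] (mono w 1)) * shifted q (MvPolynomial.pderiv k F) g w := by
  induction F using MvPolynomial.induction_on with
  | C a => simp [shifted]
  | add p p' h h' =>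
    simp only [shifted, MvPolynomial.eval₂_add, map_add] at h h' ⊢
    rw [h, h', mul_add]
  | mul_X p i h =>
    simp only [shifted, MvPolynomial.eval₂_mul, MvPolynomial.eval₂_X, MvPolynomial.pderiv_mul,
      MvPolynomial.eval₂_add, map_add, MvPolynomial.pderiv_C] at h ⊢
    rw [h]
    by_cases hik : i = k
    · subst hik
      simp only [MvPolynomial.pderiv_X_self, MvPolynomial.eval₂_one]
      ring
    · rw [MvPolynomial.pderiv_X_of_ne hik, MvPolynomial.pderiv_X_of_ne hik,
        MvPolynomial.eval₂_zero]
      ring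

/-! ### Finitely supported series -/

/-- The subring of the series with finitely many terms. -/
def finSupp : Subring FormalRing where
  carrier := {f | f.support.Finite}
  zero_mem' := by simp
  one_mem' := (Set.finite_singleton 0).subset fun e he => by
    by_contra h
    exact he (by rw [HahnSeries.coeff_one, if_neg (by simpa using h)])
  add_mem' hf hg := (hf.union hg).subset (HahnSeries.support_add_subset _ _)
  mul_mem' hf hg := (hf.add hg).subset HahnSeries.support_mul_subset
  neg_mem' hf := by simpa using hf

lemma single_mem_finSupp (e : Expo) (a : ℂ) : HahnSeries.single e a ∈ finSupp :=
  (Set.finite_singleton e).subset HahnSeries.support_single_subset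

lemma zHom_mem_finSupp (p : Polynomial ℂ) : zHom p ∈ finSupp := by
  induction p using Polynomial.induction_on' with
  | add p p' h h' => rw [map_add]; exact add_mem h h'
  | monomial m a =>
    have : zHom (Polynomial.monomial m a) = HahnSeries.C a * mono 1 1 ^ m := by
      simp [zHom, Polynomial.aeval_monomial, HahnSeries.algebraMap_apply]
    rw [this]
    exact mul_mem (single_mem_finSupp _ _) (pow_mem (single_mem_finSupp _ _) _)

lemma sigma_iterate_mem_finSupp (q : ℂ) (k : ℕ) {f : FormalRing} (hf : f ∈ finSupp) :
    (sigma q)^[k] f ∈ finSupp :=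
  Set.Finite.subset hf fun e he h => he (by rw [coeff_sigma_iterate, h, mul_zero])

lemma coeff_mul_mem {ι R : Type*} [CommRing R] (S : Subring R) {p p' : MvPolynomial ι R}
    (h : ∀ d, p.coeff d ∈ S) (h' : ∀ d, p'.coeff d ∈ S) (d : ι →₀ ℕ) : (p * p').coeff d ∈ S := by
  classical
  rw [MvPolynomial.coeff_mul]
  exact sum_mem fun x _ => mul_mem (h _) (h' _)

lemma coeff_C_mem {ι R : Type*} [CommRing R] (S : Subring R) {a : R} (ha : a ∈ S) (d : ι →₀ ℕ) :
    (MvPolynomial.C a : MvPolynomial ι R).coeff d ∈ S := by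
  classical
  rw [MvPolynomial.coeff_C]
  split_ifs
  exacts [ha, zero_mem S]

lemma coeff_X_mem {ι R : Type*} [CommRing R] (S : Subring R) (i : ι) (d : ι →₀ ℕ) :
    (MvPolynomial.X i : MvPolynomial ι R).coeff d ∈ S := by
  classical
  rw [MvPolynomial.coeff_X]
  split_ifs
  exacts [one_mem S, zero_mem S]

lemma coeff_shifted_mem_finSupp {n : ℕ} (q : ℂ) (F : QPoly n) {g : FormalRing} (hg : g ∈ finSupp)
    (w : ℂ) (d : Fin (n + 1) →₀ ℕ) : (shifted q F g w).coeff d ∈ finSupp := by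
  induction F using MvPolynomial.induction_on generalizing d with
  | C a =>
    rw [shifted, MvPolynomial.eval₂_C]
    exact coeff_C_mem _ (zHom_mem_finSupp a) d
  | add p p' h h' =>
    rw [shifted, MvPolynomial.eval₂_add, MvPolynomial.coeff_add]
    exact add_mem (h d) (h' d)
  | mul_X p i h =>
    rw [shifted, MvPolynomial.eval₂_mul, MvPolynomial.eval₂_X]
    refine coeff_mul_mem _ h (fun d => ?_) d
    rw [MvPolynomial.coeff_add]
    exact add_mem (coeff_C_mem _ (sigma_iterate_mem_finSupp q _ hg) d)
      (coeff_mul_mem _ (coeff_C_mem _ (sigma_iterate_mem_finSupp q _ (single_mem_finSupp _ _)))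
        (coeff_X_mem _ i) d)

lemma initial_mem_finSupp (φ : GenPowerSeries) (J : ℕ) : φ.initial J ∈ finSupp :=
  sum_mem fun _ _ => single_mem_finSupp _ _

lemma mono_mul_mono (v w a b : ℂ) : mono v a * mono w b = mono (v + w) (a * b) :=
  HahnSeries.single_mul_single

/-! ### The remainder of a generalized power series -/

/-- The series `ψ` in `φ = ∑_{j ≤ J} c_j z ^ {λ_j} + z ^ w ψ`. -/
def GenPowerSeries.remainder (φ : GenPowerSeries) (J : ℕ) (w : ℂ) : FormalRing :=
  mono (-w) 1 * (φ.toFormal - φ.initial J)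

lemma GenPowerSeries.toFormal_eq (φ : GenPowerSeries) (J : ℕ) (w : ℂ) :
    φ.toFormal = φ.initial J + mono w 1 * φ.remainder J w := by
  have h : mono w 1 * mono (-w) 1 = 1 := by
    rw [mono_mul_mono, add_neg_cancel, mul_one]
    rfl
  rw [remainder, ← mul_assoc, h, one_mul, add_sub_cancel]

lemma GenPowerSeries.coeff_toFormal_sub_initial (φ : GenPowerSeries) (J j : ℕ) :
    (φ.toFormal - φ.initial J).coeff (expo (φ.lam j)) = if J < j then φ.c j else 0 := by
  have hinj : Function.Injective fun j => expo (φ.lam j) := expo_injective.comp φ.lam_injective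
  have h1 : φ.toFormal.coeff (expo (φ.lam j)) = φ.c j := hinj.extend_apply _ _ _
  have h2 : ∀ i, (mono (φ.lam i) (φ.c i)).coeff (expo (φ.lam j)) = if j = i then φ.c i else 0 := by
    intro i
    rw [mono, HahnSeries.coeff_single]
    simp only [hinj.eq_iff]
  rw [HahnSeries.coeff_sub, h1, initial, HahnSeries.coeff_sum, Finset.sum_congr rfl fun i _ => h2 i,
    Finset.sum_ite_eq]
  simp only [Finset.mem_range]
  split_ifs <;> first | omega | simp

lemma GenPowerSeries.exists_of_coeff_ne_zero (φ : GenPowerSeries) (J : ℕ) {e : Expo}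
    (he : (φ.toFormal - φ.initial J).coeff e ≠ 0) :
    ∃ j, J < j ∧ φ.c j ≠ 0 ∧ e = expo (φ.lam j) := by
  by_cases h : ∃ j, expo (φ.lam j) = e
  · obtain ⟨j, rfl⟩ := h
    rw [coeff_toFormal_sub_initial] at he
    split_ifs at he with hj
    · exact ⟨j, hj, he, rfl⟩
    · exact absurd rfl he
  · refine absurd ?_ he
    have h1 : φ.toFormal.coeff e = 0 := Function.extend_apply' _ _ _ h
    rw [HahnSeries.coeff_sub, h1, initial, HahnSeries.coeff_sum, Finset.sum_eq_zero, sub_zero]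
    intro i _
    exact HahnSeries.coeff_single_of_ne fun h' => h ⟨i, h'.symm⟩

lemma coeff_mono_mul (w a : ℂ) (f : FormalRing) (e : Expo) :
    (mono w a * f).coeff e = a * f.coeff (expo (e.val - w)) := HahnSeries.coeff_single_mul

lemma GenPowerSeries.coeff_remainder (φ : GenPowerSeries) (J : ℕ) (w : ℂ) (j : ℕ) :
    (φ.remainder J w).coeff (expo (φ.lam j - w)) = if J < j then φ.c j else 0 := by
  rw [remainder, coeff_mono_mul, val_expo, one_mul, ← coeff_toFormal_sub_initial]
  congr 2
  ring

lemma GenPowerSeries.suppIn_remainder (φ : GenPowerSeries) (J : ℕ) (w : ℂ) (S : Set ℂ)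
    (hS : ∀ j, J < j → φ.c j ≠ 0 → φ.lam j - w ∈ S) : SuppIn S (φ.remainder J w) := by
  intro e he
  rw [remainder, coeff_mono_mul, one_mul] at he
  obtain ⟨j, hj, hc, h⟩ := φ.exists_of_coeff_ne_zero J he
  have h' : e.val = φ.lam j - w := by rw [← expo_injective h]; ring
  rw [h']
  exact hS j hj hc

/-! ### The linear part of the equation -/

lemma SuppIn.natCast (Γ : AddSubmonoid ℂ) (m : ℕ) : SuppIn Γ (m : FormalRing) := by
  induction m with
  | zero => rw [Nat.cast_zero]; exact SuppIn.zero _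
  | succ m ih => rw [Nat.cast_succ]; exact ih.add (SuppIn.one Γ)

lemma SuppIn.coeff_zero {Γ : AddSubmonoid ℂ} {f : FormalRing} (hf : SuppIn (nonzeroPart Γ) f) :
    f.coeff 0 = 0 := by
  by_contra h
  exact (hf 0 h).2 rfl

/-- A substitution of series without constant term does not change the constant term. -/
lemma coeff_zero_eval {ι : Type*} [Fintype ι] {Γ : AddSubmonoid ℂ}
    (hpos : ∀ g ∈ Γ, g ≠ 0 → 0 < g.re) (U : ι → FormalRing)
    (hU : ∀ k, SuppIn (nonzeroPart Γ) (U k)) (G : MvPolynomial ι FormalRing)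
    (hG : ∀ d, SuppIn Γ (G.coeff d)) :
    (MvPolynomial.eval U G).coeff 0 = (G.coeff 0).coeff 0 := by
  rw [MvPolynomial.eval_eq', HahnSeries.coeff_sum, Finset.sum_eq_single 0]
  · simp
  · intro d _ hd
    exact ((hG d).mul (suppIn_prod_pow_nonzeroPart hpos U hU hd)
      fun a ha b hb => add_mem_nonzeroPart hpos ha hb).coeff_zero
  · intro h
    rw [MvPolynomial.notMem_support_iff] at h
    simp [h]

/-- The constant term of the coefficient of `u_k` in the normalized equation. -/
lemma coeff_linear_shifted {n : ℕ} {q : ℂ} {F : QPoly n} {g : FormalRing} {a w : ℂ}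
    {Γ : AddSubmonoid ℂ} (hpos : ∀ γ ∈ Γ, γ ≠ 0 → 0 < γ.re) {ψ : FormalRing}
    (hψ : SuppIn (nonzeroPart Γ) ψ) {L : Polynomial ℂ}
    (hL : IsAssociatedPoly q F (g + mono w 1 * ψ) a L)
    (hG : ∀ d, SuppIn Γ (mono (-(a + w)) 1 * (shifted q F g w).coeff d)) (k : Fin (n + 1)) :
    (mono (-(a + w)) 1 * (shifted q F g w).coeff (Finsupp.single k 1)).coeff 0 =
      qpow q w ^ (k : ℕ) * L.coeff k := by
  set G : MvPolynomial (Fin (n + 1)) FormalRing :=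
    MvPolynomial.C (mono (-(a + w)) 1) * shifted q F g w with hGdef
  set U : Fin (n + 1) → FormalRing := fun k => (sigma q)^[k] ψ with hU
  have h1 : (MvPolynomial.pderiv k G).coeff 0 =
      mono (-(a + w)) 1 * (shifted q F g w).coeff (Finsupp.single k 1) := by
    rw [MvPolynomial.coeff_pderiv, hGdef, MvPolynomial.coeff_C_mul]
    simp
  have h2 := coeff_zero_eval hpos U (fun k => hψ.sigma_iterate q k) (MvPolynomial.pderiv k G)
    (fun d => by
      rw [MvPolynomial.coeff_pderiv, hGdef, MvPolynomial.coeff_C_mul]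
      exact (hG _).mul_mem ((SuppIn.natCast Γ _).add (SuppIn.one Γ)))
  rw [← h1, ← h2, hGdef, MvPolynomial.pderiv_C_mul, pderiv_shifted, map_mul, map_mul,
    MvPolynomial.eval_C, MvPolynomial.eval_C, hU, eval_shifted, sigma_iterate_mono, ← mul_assoc]
  have h3 : mono (-(a + w)) 1 * mono w (qpow q w ^ (k : ℕ)) = mono (-a) (qpow q w ^ (k : ℕ)) := by
    rw [mono_mul_mono, one_mul, show -(a + w) + w = -a by ring]
  rw [h3, coeff_mono_mul]
  congr 1
  have h4 : (substSeries q (MvPolynomial.pderiv k F) (g + mono w 1 * ψ) -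
      mono a (L.coeff k)).coeff (expo a) = 0 := by
    by_contra h
    exact lt_irrefl _ (hL.2.2 k _ h)
  rw [HahnSeries.coeff_sub, mono.eq_1 a, HahnSeries.coeff_single_same, sub_eq_zero] at h4
  rw [← h4, Expo.val_zero, zero_sub, neg_neg]

/-- The normal form `L(q^w σ) ψ = -Q(z, ψ, σ ψ, …, σ^n ψ)` of the equation: no linear term of `Q`
has a constant coefficient. -/
theorem exists_normal_form {n : ℕ} {q : ℂ} {F : QPoly n} {g : FormalRing} {a w : ℂ}
    (hg : g ∈ finSupp)
    {Γ : AddSubmonoid ℂ} (hpos : ∀ γ ∈ Γ, γ ≠ 0 → 0 < γ.re) {ψ : FormalRing}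
    (hψ : SuppIn (nonzeroPart Γ) ψ) (hsol : substSeries q F (g + mono w 1 * ψ) = 0)
    {L : Polynomial ℂ} (hL : IsAssociatedPoly q F (g + mono w 1 * ψ) a L)
    (hexp : ∀ (p : Fin (n + 1) →₀ ℕ) (e : Expo),
      ((shifted q F g w).coeff p).coeff e ≠ 0 → e.val - (a + w) ∈ Γ) :
    ∃ Q : MvPolynomial (Fin (n + 1)) FormalRing, (∀ d, SuppIn Γ (Q.coeff d)) ∧
      (∀ d, (Q.coeff d).support.Finite) ∧
      (∀ d : Fin (n + 1) →₀ ℕ, d.degree ≤ 1 → SuppIn (nonzeroPart Γ) (Q.coeff d)) ∧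
      ∀ e : Expo, L.eval (qpow q (w + e.val)) * ψ.coeff e =
        -(MvPolynomial.eval (fun k : Fin (n + 1) => (sigma q)^[k] ψ) Q).coeff e := by
  classical
  have hG : ∀ d, SuppIn Γ (mono (-(a + w)) 1 * (shifted q F g w).coeff d) := by
    intro d e he
    rw [coeff_mono_mul, one_mul] at he
    have := hexp d _ he
    rwa [val_expo, sub_neg_eq_add, add_sub_cancel_right] at this
  set A : Fin (n + 1) → ℂ := fun k => qpow q w ^ (k : ℕ) * L.coeff k with hA
  set G : MvPolynomial (Fin (n + 1)) FormalRing :=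
    MvPolynomial.C (mono (-(a + w)) 1) * shifted q F g w with hGdef
  set U : Fin (n + 1) → FormalRing := fun k => (sigma q)^[k] ψ with hU
  have hGd : ∀ d, G.coeff d = mono (-(a + w)) 1 * (shifted q F g w).coeff d := fun d => by
    rw [hGdef, MvPolynomial.coeff_C_mul]
  have hGU : MvPolynomial.eval U G = 0 := by
    rw [hGdef, map_mul, hU, eval_shifted, hsol, mul_zero]
  have hG0 : (G.coeff 0).coeff 0 = 0 := by
    rw [← coeff_zero_eval hpos U (fun k => hψ.sigma_iterate q k) G
      (fun d => by rw [hGd]; exact hG d), hGU, HahnSeries.coeff_zero]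
  set ℓ : MvPolynomial (Fin (n + 1)) FormalRing :=
    ∑ k, MvPolynomial.C (mono 0 (A k)) * MvPolynomial.X k with hℓ
  have hℓd : ∀ d, ℓ.coeff d = ∑ k, if Finsupp.single k 1 = d then mono 0 (A k) else 0 := by
    intro d
    rw [hℓ, MvPolynomial.coeff_sum]
    refine Finset.sum_congr rfl fun k _ => ?_
    rw [MvPolynomial.coeff_C_mul, MvPolynomial.coeff_X, mul_ite, mul_one, mul_zero]
  have hℓΓ : ∀ d, SuppIn Γ (ℓ.coeff d) := fun d => by
    rw [hℓd]
    refine SuppIn.sum _ _ fun k _ => ?_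
    split_ifs
    exacts [suppIn_single Γ.zero_mem _, SuppIn.zero _]
  have hQΓ : ∀ d, SuppIn Γ ((G - ℓ).coeff d) := fun d e he => by
    rw [MvPolynomial.coeff_sub, HahnSeries.coeff_sub] at he
    by_cases h : (G.coeff d).coeff e = 0
    · exact hℓΓ d e fun h' => he (by rw [h, h', sub_zero])
    · exact hG d e (by rwa [← hGd])
  refine ⟨G - ℓ, hQΓ, fun d => ?_, fun d hd => ?_, fun e => ?_⟩
  · have h1 : G.coeff d ∈ finSupp := by
      rw [hGd]
      exact mul_mem (single_mem_finSupp _ _) (coeff_shifted_mem_finSupp q F hg w d)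
    have h2 : ℓ.coeff d ∈ finSupp := by
      rw [hℓd]
      refine sum_mem fun k _ => ?_
      split_ifs
      exacts [single_mem_finSupp _ _, zero_mem _]
    rw [MvPolynomial.coeff_sub]
    exact sub_mem h1 h2
  · -- the constant terms cancel
    have h0 : ((G - ℓ).coeff d).coeff 0 = 0 := by
      rw [MvPolynomial.coeff_sub, HahnSeries.coeff_sub, hℓd]
      by_cases hd0 : d = 0
      · rw [hd0, hG0, Finset.sum_eq_zero, HahnSeries.coeff_zero, sub_zero]
        intro k _
        rw [if_neg (by simp)]
      · obtain ⟨i, d', rfl⟩ := exists_eq_single_add hd0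
        have hd' : d' = 0 := by
          rw [map_add, Finsupp.degree_single] at hd
          rw [← Finsupp.degree_eq_zero_iff]
          omega
        rw [hd', add_zero, hGd, coeff_linear_shifted hpos hψ hL hG, Finset.sum_eq_single i]
        · rw [if_pos rfl, mono, expo_zero, HahnSeries.coeff_single_same, sub_self]
        · intro b _ hb
          rw [if_neg fun h => hb (Finsupp.single_left_injective one_ne_zero h)]
        · simp
    intro e he
    exact ⟨hQΓ d e he, fun h => he (by rwa [Expo.val_eq_zero.mp h])⟩
  · rw [map_sub, hGU, zero_sub, HahnSeries.coeff_neg, neg_neg, hℓ, map_sum, HahnSeries.coeff_sum,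
      Polynomial.eval_eq_sum_range' (Nat.lt_succ_of_le hL.2.1), Finset.sum_range, Finset.sum_mul]
    refine Finset.sum_congr rfl fun k _ => ?_
    rw [map_mul, MvPolynomial.eval_C, MvPolynomial.eval_X, coeff_mono_mul, sub_zero, expo_val,
      hU, coeff_sigma_iterate, qpow_add, mul_pow, hA]
    ring

/-! ### The diophantine condition -/

/-- `semigroup α` as a submonoid. -/
def exponentMonoid {s : ℕ} (α : Fin s → ℂ) : AddSubmonoid ℂ where
  carrier := semigroup α
  zero_mem' := ⟨0, by simp⟩
  add_mem' := by
    rintro _ _ ⟨m, rfl⟩ ⟨m', rfl⟩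
    exact ⟨m + m', by simp [add_mul, Finset.sum_add_distrib]⟩

/-- A lower bound for the logarithmic distance, for every branch, bounds the distance. -/
lemma le_norm_exp_sub {a ω : ℂ} (ha : a ≠ 0) {t : ℝ}
    (h : ∀ k : ℤ, t < ‖ω - Complex.log a - 2 * Real.pi * (k : ℂ) * Complex.I‖) :
    ‖a‖ * min (1 / 2) (2 / 3 * t) ≤ ‖Complex.exp ω - a‖ := by
  set x := Complex.exp (ω - Complex.log a) - 1 with hx
  have h1 : Complex.exp ω - a = a * x := by
    rw [hx, Complex.exp_sub, Complex.exp_log ha]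
    field_simp
  rw [h1, norm_mul]
  refine mul_le_mul_of_nonneg_left ?_ (norm_nonneg a)
  by_contra! hlt
  have hx2 : ‖x‖ ≤ 1 / 2 := (hlt.trans_le (min_le_left _ _)).le
  have h2 := Complex.norm_log_one_add_half_le_self hx2
  have hne : 1 + x ≠ 0 := by rw [hx, add_sub_cancel]; exact Complex.exp_ne_zero _
  have h3 : Complex.exp (ω - Complex.log a) = Complex.exp (Complex.log (1 + x)) := by
    rw [Complex.exp_log hne, hx, add_sub_cancel]
  obtain ⟨k, hk⟩ := Complex.exp_eq_exp_iff_exists_int.mp h3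
  have h4 := h k
  rw [hk, show Complex.log (1 + x) + k * (2 * Real.pi * Complex.I) - 2 * Real.pi * k * Complex.I =
    Complex.log (1 + x) by ring] at h4
  linarith [hlt.trans_le (min_le_right _ _)]

lemma exists_pos_le_re {s : ℕ} (α : Fin s → ℂ) (hα : ∀ i, 0 < (α i).re) :
    ∃ w₀ : ℝ, 0 < w₀ ∧ ∀ m : Fin s → ℕ,
      ((∑ i, m i : ℕ) : ℝ) * w₀ ≤ (∑ i, (m i : ℂ) * α i).re := by
  obtain ⟨w₀, hw, hle⟩ : ∃ w₀ : ℝ, 0 < w₀ ∧ ∀ i, w₀ ≤ (α i).re := by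
    rcases isEmpty_or_nonempty (Fin s) with h | h
    · exact ⟨1, one_pos, fun i => h.elim i⟩
    · obtain ⟨i, hi⟩ := Finite.exists_min fun i => (α i).re
      exact ⟨_, hα i, hi⟩
  refine ⟨w₀, hw, fun m => ?_⟩
  push_cast
  rw [Complex.re_sum, Finset.sum_mul]
  refine Finset.sum_le_sum fun i _ => ?_
  rw [Complex.mul_re, Complex.natCast_re, Complex.natCast_im, zero_mul, sub_zero]
  exact mul_le_mul_of_nonneg_left (hle i) (Nat.cast_nonneg _)

lemma exists_abs_im_le {s : ℕ} (α : Fin s → ℂ) (hα : ∀ i, 0 < (α i).re) :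
    ∃ B : ℝ, ∀ g ∈ semigroup α, |g.im| ≤ B * g.re := by
  refine ⟨∑ i, |(α i).im| / (α i).re, ?_⟩
  rintro _ ⟨m, rfl⟩
  rw [Complex.re_sum, Complex.im_sum, Finset.mul_sum]
  refine (Finset.abs_sum_le_sum_abs _ _).trans (Finset.sum_le_sum fun i _ => ?_)
  rw [Complex.mul_re, Complex.mul_im, Complex.natCast_re, Complex.natCast_im, zero_mul, zero_mul,
    sub_zero, add_zero, abs_mul, Nat.abs_cast]
  have h1 : |(α i).im| / (α i).re ≤ ∑ i, |(α i).im| / (α i).re :=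
    Finset.single_le_sum (f := fun i => |(α i).im| / (α i).re)
      (fun i _ => div_nonneg (abs_nonneg _) (hα i).le) (Finset.mem_univ i)
  calc (m i : ℝ) * |(α i).im| = |(α i).im| / (α i).re * (m i * (α i).re) := by
        have := (hα i).ne'
        field_simp
    _ ≤ _ := mul_le_mul_of_nonneg_right h1 (mul_nonneg (Nat.cast_nonneg _) (hα i).le)

/-- The diophantine condition in multiplicative form, in terms of the real parts of the
exponents. The exponent `ν` may be enlarged, so that one value can serve for two roots. -/
lemma exists_diophantine_re {s : ℕ} (q lam : ℂ) (α : Fin s → ℂ) (hα : ∀ i, 0 < (α i).re)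
    {a : ℂ} (ha : a ≠ 0)
    (h : ∃ c ν : ℝ, 0 < c ∧ 0 < ν ∧ ∀ (m : Fin s → ℕ) (k : ℤ), m ≠ 0 →
      c * ((∑ i, m i : ℕ) : ℝ) ^ (-ν) <
        ‖(lam + ∑ i, (m i : ℂ) * α i) * lnq q - Complex.log a
          - 2 * Real.pi * (k : ℂ) * Complex.I‖) :
    ∃ ν₀ : ℝ, 0 < ν₀ ∧ ∀ ν, ν₀ ≤ ν → ∃ c', 0 < c' ∧ ∀ g ∈ semigroup α, g ≠ 0 →
      c' * g.re ^ (-ν) ≤ ‖qpow q (lam + g) - a‖ := by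
  obtain ⟨c, ν₀, hc, hν₀, h⟩ := h
  obtain ⟨w₀, hw₀, hle⟩ := exists_pos_le_re α hα
  refine ⟨ν₀, hν₀, fun ν hν => ?_⟩
  have hna : 0 < ‖a‖ := norm_pos_iff.mpr ha
  refine ⟨‖a‖ * min (1 / 2) (2 / 3 * c) * w₀ ^ ν, by positivity, ?_⟩
  rintro _ ⟨m, rfl⟩ hg0
  have hm : m ≠ 0 := by rintro rfl; simp at hg0
  set g := ∑ i, (m i : ℂ) * α i
  set N : ℝ := ((∑ i, m i : ℕ) : ℝ) with hN
  have hN1 : 1 ≤ N := by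
    obtain ⟨i, hi⟩ := Function.ne_iff.mp hm
    rw [hN, Nat.one_le_cast]
    exact (Nat.one_le_iff_ne_zero.mpr hi).trans
      (Finset.single_le_sum (f := m) (fun _ _ => Nat.zero_le _) (Finset.mem_univ i))
  have hN0 : 0 < N := one_pos.trans_le hN1
  have hgre : N * w₀ ≤ g.re := hle m
  have hmain := le_norm_exp_sub ha fun k => h m k hm
  have h1 : N ^ (-ν) ≤ 1 := Real.rpow_le_one_of_one_le_of_nonpos hN1 (by linarith)
  have h2 : N ^ (-ν) ≤ N ^ (-ν₀) := Real.rpow_le_rpow_of_exponent_le hN1 (by linarith)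
  have h3 : w₀ ^ ν * g.re ^ (-ν) ≤ N ^ (-ν) := by
    calc w₀ ^ ν * g.re ^ (-ν) ≤ w₀ ^ ν * (N * w₀) ^ (-ν) := by
          refine mul_le_mul_of_nonneg_left ?_ (by positivity)
          exact Real.rpow_le_rpow_of_nonpos (by positivity) hgre (by linarith)
      _ = _ := by
          rw [Real.mul_rpow hN0.le hw₀.le, mul_left_comm, ← Real.rpow_add hw₀, add_neg_cancel,
            Real.rpow_zero, mul_one]
  calc ‖a‖ * min (1 / 2) (2 / 3 * c) * w₀ ^ ν * g.re ^ (-ν)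
      = ‖a‖ * (min (1 / 2) (2 / 3 * c) * (w₀ ^ ν * g.re ^ (-ν))) := by ring
    _ ≤ ‖a‖ * (min (1 / 2) (2 / 3 * c) * N ^ (-ν)) := by gcongr
    _ ≤ ‖a‖ * min (1 / 2) (2 / 3 * (c * N ^ (-ν₀))) := by
        refine mul_le_mul_of_nonneg_left (le_min ?_ ?_) hna.le
        · calc _ ≤ 1 / 2 * (1 : ℝ) := mul_le_mul (min_le_left _ _) h1 (by positivity) (by norm_num)
            _ = _ := mul_one _
        · calc _ ≤ 2 / 3 * c * N ^ (-ν₀) :=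
                mul_le_mul (min_le_right _ _) h2 (by positivity) (by positivity)
            _ = _ := by ring
    _ ≤ _ := hmain

end QDiff

end

theorem theorem1 {n s : ℕ} (q : ℂ) (hq0 : q ≠ 0) (hq1 : q ≠ 1)
    (F : QDiff.QPoly n) (φ : QDiff.GenPowerSeries)
    -- `φ` is a formal solution of the equation
    (hsol : QDiff.substSeries q F φ.toFormal = 0)
    -- the associated polynomial
    (a₀ : ℂ) (L : Polynomial ℂ) (hL : QDiff.IsAssociatedPoly q F φ.toFormal a₀ L)
    (hdeg : L.natDegree = n) (hL0 : L.eval 0 ≠ 0)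
    -- the semigroup of exponents of the equation for `u`, where
    -- `y = c_0 z ^ {λ_0} + … + c_{j0} z ^ {λ_{j0}} + z ^ {λ_{j0}} u`
    (j0 : ℕ) (α : Fin s → ℂ) (hα : ∀ i, 0 < (α i).re)
    (hexp : ∀ (p : Fin (n + 1) →₀ ℕ) (e : QDiff.Expo),
      ((QDiff.shifted q F (φ.initial j0) (φ.lam j0)).coeff p).coeff e ≠ 0 →
        e.val - (a₀ + φ.lam j0) ∈ QDiff.semigroup α)
    -- the form of `φ`
    (hform : ∀ j, j0 < j → φ.c j ≠ 0 → φ.lam j - φ.lam j0 ∈ QDiff.semigroup α)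
    -- the diophantine condition
    (hdioph : ∀ a : ℂ,
      ((Polynomial.X - Polynomial.C (QDiff.qpow q (φ.lam j0))) * L).IsRoot a →
      ∃ c ν : ℝ, 0 < c ∧ 0 < ν ∧ ∀ (m : Fin s → ℕ) (k : ℤ), m ≠ 0 →
        c * ((∑ i, m i : ℕ) : ℝ) ^ (-ν) <
          ‖(φ.lam j0 + ∑ i, (m i : ℂ) * α i) * QDiff.lnq q - Complex.log a
            - 2 * Real.pi * (k : ℂ) * Complex.I‖) :
    φ.HasNonzeroRadius := by
  open QDiff in
  set lam := φ.lam j0 with hlam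
  let Γ : AddSubmonoid ℂ := exponentMonoid α
  obtain ⟨w₀, hw₀, hle⟩ := exists_pos_le_re α hα
  have hΓ : ∀ g ∈ Γ, g ≠ 0 → w₀ ≤ g.re := by
    rintro _ ⟨m, rfl⟩ hg
    refine le_trans ?_ (hle m)
    have hm : m ≠ 0 := by rintro rfl; simp at hg
    obtain ⟨i, hi⟩ := Function.ne_iff.mp hm
    refine le_mul_of_one_le_left hw₀.le ?_
    rw [Nat.one_le_cast]
    exact (Nat.one_le_iff_ne_zero.mpr hi).trans
      (Finset.single_le_sum (f := m) (fun _ _ => Nat.zero_le _) (Finset.mem_univ i))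
  have hpos : ∀ g ∈ Γ, g ≠ 0 → 0 < g.re := fun g hg h => hw₀.trans_le (hΓ g hg h)
  obtain ⟨B, hB⟩ := exists_abs_im_le α hα
  have hqlam : qpow q lam ≠ 0 := qpow_ne_zero q lam
  have hnq : 0 < ‖qpow q lam‖ := norm_pos_iff.mpr hqlam
  -- the divisors `q ^ g - 1`, from the condition at the root `q ^ λ`
  obtain ⟨ν₁, hν₁, hdio1⟩ := exists_diophantine_re q lam α hα hqlam
    (hdioph _ (by simp [Polynomial.IsRoot]))
  obtain ⟨P, T, K, C, hC, hP, hT, hTP, hadd, hdiv⟩ := exists_potential_of_polynomial Γ hpos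
    (fun g => qpow q (lam + g)) (qpow q) (fun g d => by rw [← add_assoc, qpow_add]) L hL.1
    (by
      intro a ha
      have ha0 : a ≠ 0 := by rintro rfl; exact hL0 ha
      refine ⟨ha0, ?_⟩
      obtain ⟨ν₂, hν₂, hdio2⟩ := exists_diophantine_re q lam α hα ha0
        (hdioph a (by simp [Polynomial.IsRoot, ha.eq_zero]))
      obtain ⟨c₁, hc₁, h1⟩ := hdio1 (max ν₁ ν₂) (le_max_left _ _)
      obtain ⟨c₂, hc₂, h2⟩ := hdio2 (max ν₁ ν₂) (le_max_right _ _)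
      refine ⟨min c₂ (c₁ / ‖qpow q lam‖), max ν₁ ν₂, lt_min hc₂ (by positivity),
        lt_max_of_lt_left hν₁, fun g hg hg0 => ?_⟩
      have hp : 0 < g.re ^ (-max ν₁ ν₂) := Real.rpow_pos_of_pos (hpos g hg hg0) _
      constructor
      · exact (mul_le_mul_of_nonneg_right (min_le_left _ _) hp.le).trans (h2 g hg hg0)
      · have h3 := h1 g hg hg0
        rw [qpow_add, ← mul_sub_one, norm_mul] at h3
        calc _ ≤ c₁ / ‖qpow q lam‖ * g.re ^ (-max ν₁ ν₂) :=
              mul_le_mul_of_nonneg_right (min_le_right _ _) hp.le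
          _ = (c₁ * g.re ^ (-max ν₁ ν₂)) / ‖qpow q lam‖ := by ring
          _ ≤ _ := by rw [div_le_iff₀ hnq]; linarith)
  set ψ := φ.remainder j0 lam with hψdef
  have hφ : φ.toFormal = φ.initial j0 + mono lam 1 * ψ := φ.toFormal_eq j0 lam
  have hψ : SuppIn (nonzeroPart Γ) ψ := φ.suppIn_remainder j0 lam _ fun j hj hc =>
    ⟨hform j hj hc, fun h => hj.ne' (φ.lam_injective (sub_eq_zero.mp h))⟩
  rw [hφ] at hsol hL
  obtain ⟨Q, hQ, hQfin, hQ1, hlin⟩ := exists_normal_form (initial_mem_finSupp φ j0) hpos hψ hsol hL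
    hexp
  obtain ⟨r, hr, hsum⟩ := exists_wnorm_lt_top Γ w₀ hw₀ hΓ P T (fun g hg => (hP g hg).1) hT hTP hadd
    (fun k : Fin (n + 1) => (sigma q)^[k] ψ) (fun k => hψ.sigma_iterate q k) Q hQ hQfin hQ1
    (C * max 1 ‖qpow q lam‖⁻¹ ^ n) (by
      intro k e he
      have h1 := hdiv e.val he.1 he.2 k (by rw [hdeg]; omega)
      have h2 := congrArg norm (hlin e)
      rw [norm_mul, norm_neg] at h2
      rw [coeff_sigma_iterate, norm_mul, norm_pow, ← h2]
      -- `σ ^ k` multiplies by `q ^ (k e)`, whereas `ξ = q ^ (λ + e)`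
      have h3 : ‖qpow q e.val‖ = ‖qpow q (lam + e.val)‖ * ‖qpow q lam‖⁻¹ := by
        rw [qpow_add, norm_mul]
        field_simp
      have h4 : ‖qpow q lam‖⁻¹ ^ (k : ℕ) ≤ max 1 ‖qpow q lam‖⁻¹ ^ n :=
        (pow_le_pow_left₀ (by positivity) (le_max_right _ _) _).trans
          (pow_le_pow_right₀ (le_max_left _ _) (by omega))
      rw [h3, mul_pow]
      calc _ ≤ C * (‖L.eval (qpow q (lam + e.val))‖ * Real.exp (T e.val)) *
            max 1 ‖qpow q lam‖⁻¹ ^ n * ‖ψ.coeff e‖ := by gcongr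
        _ = _ := by ring)
  have hsum0 := summable_of_wnorm_lt_top hr (fun g hg => (hP g hg).2)
    (hψ.mono (nonzeroPart_subset Γ)) (hsum 0)
  refine φ.hasNonzeroRadius_of_summable lam j0 B (fun j hj hc => hB _ (hform j hj hc))
    (r * Real.exp (-K)) (by positivity) ?_
  have hinj : Function.Injective fun j => expo (φ.lam j - lam) :=
    expo_injective.comp ((sub_left_injective (b := lam)).comp φ.lam_injective)
  refine (hsum0.comp_injective hinj).congr fun j => ?_
  simp only [Function.comp_apply, hψdef, φ.coeff_remainder, val_expo]
  split_ifs <;> simp
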